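/- Let $k$ be a field, $X$ a finite set and $\deg : X\to\mathbb R_{>0}$ a function. For $S\subseteq X$ let $F_S$ be the free algebra $k\langle S\rangle$ (finitely generated case) or the algebra $k\langle\langle S\rangle\rangle$ of noncommutative formal power series (completed case). The degree of a word is the sum of the degrees of its letters, and the degree of a nonzero element of $F_S$ is the least degree of a word that occurs in it. Let $R\subset F_S$ be a set of nonzero elements with zero constant term, and let $A=F_S/(R)$, where $(R)$ is the two-sided ideal generated by $R$ (in the completed case, the closure of that ideal). Put $$f_{S,R}(z)=1-\sum_{x\in S}z^{\deg x}+\sum_{r\in R}z^{\deg r}.$$ The algebra $A$, with generators the images of $S$ and the degree function $\deg|_S$, is called weak Golod–Shafarevich (respectively Golod–Shafarevich) if it has such a presentation for which, for some $z_0\in[0,1]$, the series $f_{S,R}(z_0)$ converges and $f_{S,R}(z_0)\le 0$ (respectively $f_{S,R}(z_0)<0$). Let $A_0\to A_1\to A_2\to\cdots$ be surjective homomorphisms of $k$-algebras, with a map $X\to A_0$, and consider the induced maps $X\to A_i$. Suppose that for each $i$ there is a subset $S_i\subseteq X$ such that $A_i$, with generators the images of the elements of $S_i$ and the degree function $\deg|_{S_i}$,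 is weak Golod–Shafarevich, and that for all but finitely many $i$ it is Golod–Shafarevich with respect to these generators and degrees. Then the direct limit $A=\varinjlim A_i$ has exponential growth. Here, in the finitely generated case, exponential growth of $A$ means that for a finite generating set of $A$ there is $c>1$ such that, for all large $n$, the products of at most $n$ generators span a space of dimension at least $c^n$ (this does not depend on the generating set). In the completed case it means that for a surjection $k\langle\langle Y\rangle\rangle\to A$ with $Y$ finite there is $c>1$ such that $\dim_k (A/A_{n})\ge c^n$ for all large $n$, where $A_{n}$ is the image of the set of series without monomials of length less than $n$ (this does not depend on the surjection); in this case the claim holds both for the algebraic direct limit and for its quotient by the closure of $0$, which is the direct limit in the category of completed algebras. -/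

import Mathlib

open Filter

/-- The completed free algebra `k⟪ι⟫`: noncommutative formal power series in the variables `ι`
over `k`, i.e. arbitrary functions from words (lists of variables) to `k`. -/
def NCPowerSeries (k ι : Type*) : Type _ := List ι → k

namespace NCPowerSeries

@[ext] theorem ext {k ι : Type*} {f g : NCPowerSeries k ι} (h : ∀ w, f w = g w) : f = g :=
  funext h

variable {k ι : Type*} [Field k]

noncomputable instance : AddCommGroup (NCPowerSeries k ι) :=
  inferInstanceAs (AddCommGroup (List ι → k))

noncomputable instance : Module k (NCPowerSeries k ι) :=
  inferInstanceAs (Module k (List ι → k))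

/-- The constant series `1`. -/
noncomputable instance : One (NCPowerSeries k ι) where
  one := fun w => match w with
    | [] => 1
    | _ :: _ => 0

/-- The product: the coefficient of `f * g` at `w` is the sum of `f u * g v` over all
factorizations `w = u v` of the word `w`. -/
noncomputable instance : Mul (NCPowerSeries k ι) where
  mul f g := fun w => ∑ i ∈ Finset.range (w.length + 1), f (w.take i) * g (w.drop i)

/-- The series `f'` with `f' w = f (x w)`. -/
def shift (x : ι) (f : NCPowerSeries k ι) : NCPowerSeries k ι := fun w => f (x :: w)

theorem add_apply (f g : NCPowerSeries k ι) (w : List ι) : (f + g) w = f w + g w := rfl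
theorem zero_apply (w : List ι) : (0 : NCPowerSeries k ι) w = 0 := rfl
theorem smul_apply (c : k) (f : NCPowerSeries k ι) (w : List ι) : (c • f) w = c * f w := rfl
theorem one_nil : (1 : NCPowerSeries k ι) [] = 1 := rfl
theorem one_cons (x : ι) (w : List ι) : (1 : NCPowerSeries k ι) (x :: w) = 0 := rfl
theorem mul_apply (f g : NCPowerSeries k ι) (w : List ι) :
    (f * g) w = ∑ i ∈ Finset.range (w.length + 1), f (w.take i) * g (w.drop i) := rfl
theorem mul_nil (f g : NCPowerSeries k ι) : (f * g) [] = f [] * g [] := by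
  simp [mul_apply]
theorem mul_cons (f g : NCPowerSeries k ι) (x : ι) (w : List ι) :
    (f * g) (x :: w) = (shift x f * g) w + f [] * g (x :: w) := by
  rw [mul_apply, List.length_cons, Finset.sum_range_succ', mul_apply]
  rfl

theorem ncps_mul_assoc (f g h : NCPowerSeries k ι) : f * g * h = f * (g * h) := by
  ext w
  induction w generalizing f with
  | nil => simp only [mul_nil, mul_assoc]
  | cons x w ih =>
    have key : shift x (f * g) = shift x f * g + f [] • shift x g := by
      ext u
      exact mul_cons f g x u
    have hadd : ∀ a b : NCPowerSeries k ι, ((a + b) * h) w = (a * h) w + (b * h) w := by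
      intro a b
      simp only [mul_apply, add_apply, add_mul, Finset.sum_add_distrib]
    have hsmul : ∀ (c : k) (a : NCPowerSeries k ι), ((c • a) * h) w = c * (a * h) w := by
      intro c a
      simp only [mul_apply, smul_apply, Finset.mul_sum, mul_assoc]
    rw [mul_cons, key, hadd, hsmul, ih, mul_cons, mul_cons, mul_nil]
    ring

noncomputable instance : Ring (NCPowerSeries k ι) where
  __ := (inferInstance : AddCommGroup (NCPowerSeries k ι))
  mul := (· * ·)
  one := 1
  mul_assoc := ncps_mul_assoc
  left_distrib f g h := by
    ext w
    simp only [mul_apply, add_apply, mul_add, Finset.sum_add_distrib]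
  right_distrib f g h := by
    ext w
    simp only [mul_apply, add_apply, add_mul, Finset.sum_add_distrib]
  zero_mul f := by
    ext w
    simp only [mul_apply, zero_apply, zero_mul, Finset.sum_const_zero]
  mul_zero f := by
    ext w
    simp only [mul_apply, zero_apply, mul_zero, Finset.sum_const_zero]
  one_mul f := by
    ext w
    cases w with
    | nil => rw [mul_nil, one_nil, one_mul]
    | cons x w =>
      have h0 : shift x (1 : NCPowerSeries k ι) = 0 := rfl
      rw [mul_cons, h0, one_nil, one_mul, mul_apply]
      simp [zero_apply]
  mul_one f := by
    ext w
    induction w generalizing f with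
    | nil => rw [mul_nil, one_nil, mul_one]
    | cons x w ih =>
      rw [mul_cons, ih, one_cons, mul_zero, add_zero]
      rfl

noncomputable instance : Algebra k (NCPowerSeries k ι) :=
  Algebra.ofModule
    (fun c f g => by
      ext w
      simp only [mul_apply, smul_apply, Finset.mul_sum, mul_assoc])
    (fun c f g => by
      ext w
      simp only [mul_apply, smul_apply, Finset.mul_sum, mul_left_comm])

open Classical in
/-- The variable `x`, as a power series. -/
noncomputable def X (x : ι) : NCPowerSeries k ι := fun w => if w = [x] then 1 else 0

/-- The subspace of the power series all of whose monomials have length at least `n`. -/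
def lengthFiltration (k ι : Type*) [Field k] (n : ℕ) : Submodule k (NCPowerSeries k ι) where
  carrier := {f | ∀ w : List ι, w.length < n → f w = 0}
  add_mem' {f g} hf hg w hw := by rw [add_apply, hf w hw, hg w hw, add_zero]
  zero_mem' _ _ := rfl
  smul_mem' c f hf w hw := by rw [smul_apply, hf w hw, mul_zero]

/-- Membership in the closed two-sided ideal generated by `R`: the closure of the two-sided ideal
generated by `R`, for the topology defined by `lengthFiltration`. When `ι` is finite this is also
the topology of the filtration by any positive degree function. -/
def MemClosedSpan (R : Set (NCPowerSeries k ι)) (f : NCPowerSeries k ι) : Prop :=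
  ∀ n : ℕ, ∃ g ∈ TwoSidedIdeal.span R, f - g ∈ lengthFiltration k ι n

end NCPowerSeries

namespace GolodShafarevich

/-- The coefficient of a word in an element of the free algebra. -/
noncomputable def wordCoeff {k ι : Type*} [Field k] (f : FreeAlgebra k ι) (w : List ι) : k :=
  (FreeAlgebra.equivMonoidAlgebraFreeMonoid f).coeff (FreeMonoid.ofList w)

/-- The degree of a word: the sum of the degrees of its letters. -/
def wordDegree {ι : Type*} (d : ι → ℝ) (w : List ι) : ℝ := (w.map d).sum

/-- The degree of a nonzero element of `k⟨ι⟩` or `k⟪ι⟫` with coefficients `a`: the least degree of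
a word that occurs in it. -/
noncomputable def degree {k ι : Type*} [Field k] (d : ι → ℝ) (a : List ι → k) : ℝ :=
  sInf {t | ∃ w, a w ≠ 0 ∧ t = wordDegree d w}

/-- Convergence at `z` of `H_R(z) = ∑_{r ∈ R} z ^ (deg r)`, hence of `f = 1 - H_X + H_R`; here
`a r` is the family of coefficients of `r`. -/
def SeriesConverges {k ι F : Type*} [Field k] (d : ι → ℝ) (a : F → List ι → k) (R : Set F)
    (z : ℝ) : Prop :=
  Summable fun r : R => z ^ degree d (a r)

/-- The value at `z` of `f = 1 - H_X + H_R`. -/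
noncomputable def seriesValue {k ι F : Type*} [Field k] [Fintype ι] (d : ι → ℝ)
    (a : F → List ι → k) (R : Set F) (z : ℝ) : ℝ :=
  1 - ∑ x, z ^ d x + ∑' r : R, z ^ degree d (a r)

section Presentations

variable {k ι A : Type*} [Field k] [Ring A] [Algebra k A]

/-- `A = k⟨ι | R⟩` via `π`, where `R` consists of nonzero elements without constant term. -/
def IsPresentedBy (π : FreeAlgebra k ι →ₐ[k] A) (R : Set (FreeAlgebra k ι)) : Prop :=
  (∀ r ∈ R, r ≠ 0 ∧ wordCoeff r [] = 0) ∧ Function.Surjective π ∧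
    ∀ f, π f = 0 ↔ f ∈ TwoSidedIdeal.span R

/-- `A` is the quotient of `k⟪ι⟫` by the closed ideal generated by `R`, via `π`, where `R` consists
of nonzero elements without constant term. -/
def IsCompletedPresentedBy (π : NCPowerSeries k ι →ₐ[k] A) (R : Set (NCPowerSeries k ι)) : Prop :=
  (∀ r ∈ R, r ≠ 0 ∧ r [] = 0) ∧ Function.Surjective π ∧
    ∀ f, π f = 0 ↔ NCPowerSeries.MemClosedSpan R f

variable [Fintype ι]

/-- `A`, with the generators `π (ι x)` of degrees `d x`, is weak Golod–Shafarevich. -/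
def IsWeakGS (π : FreeAlgebra k ι →ₐ[k] A) (d : ι → ℝ) : Prop :=
  ∃ R, IsPresentedBy π R ∧ ∃ z ∈ Set.Icc (0 : ℝ) 1,
    SeriesConverges d wordCoeff R z ∧ seriesValue d wordCoeff R z ≤ 0

/-- `A`, with the generators `π (ι x)` of degrees `d x`, is Golod–Shafarevich. -/
def IsGS (π : FreeAlgebra k ι →ₐ[k] A) (d : ι → ℝ) : Prop :=
  ∃ R, IsPresentedBy π R ∧ ∃ z ∈ Set.Icc (0 : ℝ) 1,
    SeriesConverges d wordCoeff R z ∧ seriesValue d wordCoeff R z < 0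

/-- The completed algebra `A`, with the (topological) generators `π (X x)` of degrees `d x`, is
weak Golod–Shafarevich. -/
def IsCompletedWeakGS (π : NCPowerSeries k ι →ₐ[k] A) (d : ι → ℝ) : Prop :=
  ∃ R : Set (NCPowerSeries k ι), IsCompletedPresentedBy π R ∧ ∃ z ∈ Set.Icc (0 : ℝ) 1,
    SeriesConverges d (fun (r : NCPowerSeries k ι) (w : List ι) => r w) R z ∧
      seriesValue d (fun (r : NCPowerSeries k ι) (w : List ι) => r w) R z ≤ 0

/-- The completed algebra `A`, with the (topological) generators `π (X x)` of degrees `d x`, is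
Golod–Shafarevich. -/
def IsCompletedGS (π : NCPowerSeries k ι →ₐ[k] A) (d : ι → ℝ) : Prop :=
  ∃ R : Set (NCPowerSeries k ι), IsCompletedPresentedBy π R ∧ ∃ z ∈ Set.Icc (0 : ℝ) 1,
    SeriesConverges d (fun (r : NCPowerSeries k ι) (w : List ι) => r w) R z ∧
      seriesValue d (fun (r : NCPowerSeries k ι) (w : List ι) => r w) R z < 0

end Presentations

/-- Exponential growth of a finitely generated algebra: for a finite generating set `s`, the
dimension of the span of the products of at most `n` elements of `s` is at least `c ^ n` for some
`c > 1` and all large `n`. (Whether this holds does not depend on `s`.) -/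
def HasExponentialGrowth (k B : Type*) [Field k] [Ring B] [Algebra k B] : Prop :=
  ∃ s : Finset B, Algebra.adjoin k (s : Set B) = ⊤ ∧ ∃ c : ℝ, 1 < c ∧ ∀ᶠ n : ℕ in atTop,
    c ^ n ≤ Module.finrank k ↥(Submodule.span k (insert 1 (s : Set B)) ^ n)

/-- Exponential growth of a quotient `B` of a completed free algebra in finitely many variables:
for a surjection `π` from such an algebra, the finite-dimensional spaces `B / B_n`, where `B_n` is
the image of the series with no monomials of length less than `n`, have dimension at least `c ^ n`
for some `c > 1` and all large `n`. (Whether this holds does not depend on `π`.) -/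
def HasCompletedExponentialGrowth (k B : Type*) [Field k] [Ring B] [Algebra k B] : Prop :=
  ∃ (m : ℕ) (π : NCPowerSeries k (Fin m) →ₐ[k] B), Function.Surjective π ∧
    ∃ c : ℝ, 1 < c ∧ ∀ᶠ n : ℕ in atTop,
      c ^ n ≤ Module.finrank k
        (B ⧸ (NCPowerSeries.lengthFiltration k (Fin m) n).map π.toLinearMap)

/-- `p : L → B` is the largest separated quotient of the quotient `L` (via `q`) of a completed free
algebra: `p` is surjective and its kernel is the closure of `0` in `L`. -/
def IsSeparatedQuotient {k ι L B : Type*} [Field k] [Ring L] [Algebra k L] [Ring B] [Algebra k B]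
    (q : NCPowerSeries k ι →ₐ[k] L) (p : L →ₐ[k] B) : Prop :=
  Function.Surjective p ∧
    ∀ b, p b = 0 ↔ ∀ n, b ∈ (NCPowerSeries.lengthFiltration k ι n).map q.toLinearMap

end GolodShafarevich

/-!
Write `F` for the free or the completed free algebra on finitely many generators of degrees `d x`,
and, for an ideal `I`, let `a_I t` be the dimension of `F / (I + F_{≥ t})`, where `F_{≥ t}` consists
of the elements all of whose words have degree at least `t`. If `I` is generated by `R`, then
`1 + ∑ a_I (t - d x) ≤ a_I t + ∑ a_I (t - deg r)` for `t > 0`, where only the relations `r` of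
degree less than `t` matter (`WordAlgebra.gs_inequality`). In the completed case the closure of the
ideal makes no difference, since `F_{≥ t}` is open.

As there are finitely many subsets of `X`, infinitely many of the `A i` have the same generators,
so that they are quotients of one `F` by an increasing chain of ideals `I j`. In the completed case
this needs that homomorphisms from `k⟪ι⟫` to a quotient by a closed ideal are determined on
the variables (`NCPowerSeries.algHom_ext_of_separated`). Let `a` belong to the union of the `I j`.
As `F / F_{≥ T}` is finite-dimensional, `a` agrees on `(-∞, T]` with `a_{I j}` for all large `j`, so
it satisfies the inequality for `t ≤ T` with the relations of any such `A j` of degree less than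
`T` (`WordAlgebra.exists_forall_sup_degGE_eq`).

Multiplying the inequality by `z ^ t` and integrating over `[0, T]` gives
`∫ z ^ t ≤ C * a T * z ^ (T - D)`, with `D` a bound for the degrees of the generators, as soon as
`1 - ∑ z ^ d x + ∑ z ^ deg r ≤ 0` for the relations of degree less than `T`
(`le_mul_of_gs_inequality`). Such a `z` is bounded away from `0`, as `∑ z ^ d x ≥ 1`. So
`a T` grows at least like `q ^ (-T)`, provided that one `q < 1` exists such that for every `T`
infinitely many `j` admit such a `z` in `(0, q]`. This is
`exists_lt_one_frequently_truncated`, the place where strictness of `f < 0` is used: `k[x, y]`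
has polynomial growth, and for it `f = (1 - z) ^ 2` vanishes at `z = 1` only. If the given points
tend to `1`, the relations of degree less than `T` are boundedly many and of discrete degrees, so
that one function of `z` serves for infinitely many `j`, and it is negative at some `z < 1`.

A lower bound for `a` bounds both notions of growth, because words of length at least `n` have
degree at least `n` times the least degree of a generator. Passing to the separated quotient
changes the kernel only within its closure, which does not affect the dimensions.
-/

namespace GolodShafarevich

/-! ### Growth from an inequality of Golod–Shafarevich type -/

section Analysis

open MeasureTheory intervalIntegral

theorem intervalIntegrable_mul_rpow {a : ℝ → ℝ} (ha : Monotone a) {z : ℝ} (hz : 0 < z)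
    (e u v : ℝ) : IntervalIntegrable (fun t => a (t - e) * z ^ t) volume u v := by
  have h1 : Monotone fun t => a (t - e) := fun s t h => ha (by linarith)
  exact h1.intervalIntegrable.mul_continuousOn
    (Continuous.continuousOn (by fun_prop (disch := exact hz.ne')))

theorem intervalIntegrable_sum_mul_rpow {κ : Type*} {a : ℝ → ℝ} (ha : Monotone a) {z : ℝ}
    (hz : 0 < z) (s : Finset κ) (b : κ → ℝ) (u v : ℝ) :
    IntervalIntegrable (fun t => ∑ r ∈ s, a (t - b r) * z ^ t) volume u v := by
  have h := IntervalIntegrable.sum s (f := fun r t => a (t - b r) * z ^ t) (a := u) (b := v)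
    (μ := volume) fun r _ => intervalIntegrable_mul_rpow ha hz _ _ _
  rwa [Finset.sum_fn] at h

theorem integral_comp_sub_mul_rpow {a : ℝ → ℝ} (ha : Monotone a) (ha0 : ∀ t ≤ 0, a t = 0) {z : ℝ}
    (hz : 0 < z) {e : ℝ} (he : 0 ≤ e) (T : ℝ) :
    ∫ t in (0 : ℝ)..T, a (t - e) * z ^ t = z ^ e * ∫ t in (0 : ℝ)..(T - e), a t * z ^ t := by
  have hI := fun u v => by simpa using intervalIntegrable_mul_rpow ha hz 0 u v
  have h1 : ∀ t, a (t - e) * z ^ t = (fun s => z ^ e * (a s * z ^ s)) (t - e) := by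
    intro t
    have : z ^ t = z ^ e * z ^ (t - e) := by rw [← Real.rpow_add hz]; ring_nf
    simp only [this]; ring
  simp_rw [h1]
  rw [integral_comp_sub_right (fun s => z ^ e * (a s * z ^ s)),
    intervalIntegral.integral_const_mul,
    ← integral_add_adjacent_intervals (hI (0 - e) 0) (hI 0 (T - e))]
  have h2 : ∫ t in (0 - e)..0, a t * z ^ t = 0 := by
    rw [integral_congr (g := fun _ => (0 : ℝ)),
      intervalIntegral.integral_zero]
    intro t ht
    rw [Set.uIcc_of_le (by linarith)] at ht
    simp [ha0 t ht.2]
  rw [h2, zero_add]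

/-- The Golod–Shafarevich inequality forces growth. Multiplied by `z ^ t` and integrated over
`[0, T]`, it bounds the integral of `z ^ t` by the contribution to `∫ a t * z ^ t` of a window
of bounded length below `T`, which is at most a constant times `a T * q ^ T`. -/
theorem le_mul_of_gs_inequality {ι ρ : Type*} [Fintype ι] (s : Finset ρ) {d : ι → ℝ} {D : ℝ}
    (hd : ∀ x, 0 < d x) (hD : ∀ x, d x ≤ D) {e : ρ → ℝ} {T : ℝ} (he : ∀ r ∈ s, 0 ≤ e r)
    {a : ℝ → ℝ} (ha : Monotone a) (ha0 : ∀ t ≤ 0, a t = 0) (hT1 : 1 ≤ T) (hDT : D ≤ T)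
    (hineq : ∀ t, 0 < t → t ≤ T →
      1 + ∑ x, a (t - d x) ≤ a t + ∑ r ∈ s, a (t - e r))
    {z q : ℝ} (hz : 0 < z) (hzq : z ≤ q) (hq : q < 1)
    (hf : 1 - ∑ x, z ^ d x + ∑ r ∈ s, z ^ e r ≤ 0) :
    z ≤ Fintype.card ι * (D * (a T * q ^ (T - D))) := by
  have hz1 : z < 1 := hzq.trans_lt hq
  have hann : ∀ t, 0 ≤ a t := fun t => by
    rcases le_total t 0 with h | h
    · exact (ha0 t h).ge
    · rw [← ha0 0 le_rfl]; exact ha h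
  have hI := fun u v => by simpa using intervalIntegrable_mul_rpow ha hz 0 u v
  have hZ : ∀ u v, IntervalIntegrable (fun t : ℝ => z ^ t) volume u v := fun u v =>
    (Continuous.intervalIntegrable (by fun_prop (disch := exact hz.ne')) _ _)
  set P : ℝ → ℝ := fun u => ∫ t in (0 : ℝ)..u, a t * z ^ t with hP
  have hPsub : ∀ u v, P v - P u = ∫ t in u..v, a t * z ^ t := fun u v =>
    integral_interval_sub_left (hI _ _) (hI _ _)
  have hPmono : ∀ r ∈ s, P (T - e r) ≤ P T := fun r hr => by
    rw [← sub_nonneg, hPsub]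
    exact integral_nonneg (by linarith [he r hr]) fun t _ =>
      mul_nonneg (hann t) (Real.rpow_nonneg hz.le t)
  have hPT : 0 ≤ P T := integral_nonneg (by linarith) fun t _ =>
      mul_nonneg (hann t) (Real.rpow_nonneg hz.le t)
  have hwin : ∀ x, P T - P (T - d x) ≤ D * (a T * q ^ (T - D)) := fun x => by
    rw [hPsub]
    have h1 : ∫ t in (T - d x)..T, a t * z ^ t ≤ ∫ _t in (T - d x)..T, a T * q ^ (T - D) := by
      refine integral_mono_on (by linarith [hd x]) (hI _ _) (by simp) fun t ht => ?_
      have h2 : z ^ t ≤ q ^ (T - D) :=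
        (Real.rpow_le_rpow_of_exponent_ge hz hz1.le (by linarith [ht.1, hD x])).trans
          (Real.rpow_le_rpow hz.le hzq (by linarith))
      exact mul_le_mul (ha ht.2) h2 (Real.rpow_nonneg hz.le t) (hann T)
    rw [intervalIntegral.integral_const, smul_eq_mul, sub_sub_cancel] at h1
    refine h1.trans (mul_le_mul_of_nonneg_right (hD x) ?_)
    exact mul_nonneg (hann T) (Real.rpow_nonneg (hz.le.trans hzq) _)
  have hsumI := intervalIntegrable_sum_mul_rpow ha hz Finset.univ d
  have hsumI' := intervalIntegrable_sum_mul_rpow ha hz s e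
  have hmain : (∫ t in (0 : ℝ)..T, z ^ t) + ∑ x, z ^ d x * P (T - d x) ≤
      P T + ∑ r ∈ s, z ^ e r * P (T - e r) := by
    have h1 : ∫ t in (0 : ℝ)..T, (z ^ t + ∑ x, a (t - d x) * z ^ t) ≤
        ∫ t in (0 : ℝ)..T, (a t * z ^ t + ∑ r ∈ s, a (t - e r) * z ^ t) := by
      refine integral_mono_on_of_le_Ioo (by linarith) ((hZ _ _).add (hsumI _ _))
        ((hI _ _).add (hsumI' _ _)) fun t ht => ?_
      have := mul_le_mul_of_nonneg_right (hineq t ht.1 ht.2.le) (Real.rpow_nonneg hz.le t)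
      simpa only [add_mul, one_mul, Finset.sum_mul] using this
    rw [integral_add (hZ _ _) (hsumI _ _), integral_add (hI _ _) (hsumI' _ _),
      integral_finsetSum fun x _ => intervalIntegrable_mul_rpow ha hz _ _ _,
      integral_finsetSum fun x _ => intervalIntegrable_mul_rpow ha hz _ _ _] at h1
    refine le_trans (le_of_eq ?_) (h1.trans (le_of_eq ?_))
    · congr 1
      exact Finset.sum_congr rfl fun x _ =>
        (integral_comp_sub_mul_rpow ha ha0 hz (hd x).le T).symm
    · congr 1
      exact Finset.sum_congr rfl fun r hr =>
        integral_comp_sub_mul_rpow ha ha0 hz (he r hr) T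
  have hlow : z ≤ ∫ t in (0 : ℝ)..T, z ^ t := by
    have h1 : ∫ _t in (0 : ℝ)..1, z ≤ ∫ t in (0 : ℝ)..1, z ^ t :=
      integral_mono_on zero_le_one (by simp) (hZ _ _) fun t ht => by
        simpa using Real.rpow_le_rpow_of_exponent_ge hz hz1.le ht.2
    have h2 : 0 ≤ ∫ t in (1 : ℝ)..T, z ^ t :=
      integral_nonneg hT1 fun t _ => Real.rpow_nonneg hz.le t
    rw [← integral_add_adjacent_intervals (hZ 0 1) (hZ 1 T)]
    simp only [intervalIntegral.integral_const, sub_zero, one_smul] at h1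
    linarith
  have hR : ∑ r ∈ s, z ^ e r * P (T - e r) ≤ (∑ r ∈ s, z ^ e r) * P T := by
    rw [Finset.sum_mul]
    exact Finset.sum_le_sum fun r hr =>
      mul_le_mul_of_nonneg_left (hPmono r hr) (Real.rpow_nonneg hz.le _)
  have hS : ∑ x, z ^ d x * (P T - P (T - d x)) ≤
      Fintype.card ι * (D * (a T * q ^ (T - D))) := by
    rw [← nsmul_eq_mul, ← Finset.card_univ]
    refine Finset.sum_le_card_nsmul _ _ _ fun x _ => ?_
    have h1 : z ^ d x ≤ 1 := Real.rpow_le_one hz.le hz1.le (hd x).le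
    have h2 : 0 ≤ P T - P (T - d x) := by
      rw [hPsub]
      exact integral_nonneg (by linarith [hd x]) fun t _ =>
        mul_nonneg (hann t) (Real.rpow_nonneg hz.le t)
    exact (mul_le_of_le_one_left h2 h1).trans (hwin x)
  simp only [mul_sub, Finset.sum_sub_distrib, ← Finset.sum_mul] at hS
  nlinarith [mul_nonneg hPT (neg_nonneg.2 hf)]

end Analysis

/-! ### Limits of Golod–Shafarevich presentations -/

section Truncation

theorem sum_rpow_le_tsum {ρ : Type*} {e : ρ → ℝ} {z : ℝ} (hz : 0 ≤ z)
    (hs : Summable fun r => z ^ e r) (s : Finset ρ) : ∑ r ∈ s, z ^ e r ≤ ∑' r, z ^ e r :=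
  hs.sum_le_tsum s fun _ _ => Real.rpow_nonneg hz _

/-- If `f < 0` at a positive `z ≤ 1`, the number of relations of degree less than `T` is at most
`|ι| / z ^ T`. -/
theorem card_mul_rpow_le {ι ρ : Type*} [Fintype ι] {d : ι → ℝ} (hd : ∀ x, 0 < d x)
    {e : ρ → ℝ} {z : ℝ} (hz : 0 < z) (hz1 : z ≤ 1) (hs : Summable fun r => z ^ e r)
    (hf : 1 - ∑ x, z ^ d x + ∑' r, z ^ e r < 0) {T : ℝ} (s : Finset ρ) (h : ∀ r ∈ s, e r < T) :
    (s.card : ℝ) * z ^ T ≤ Fintype.card ι := by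
  have h1 : s.card • z ^ T ≤ ∑ r ∈ s, z ^ e r :=
    Finset.card_nsmul_le_sum _ _ _ fun r hr =>
      Real.rpow_le_rpow_of_exponent_ge hz hz1 (h r hr).le
  have h2 := sum_rpow_le_tsum hz.le hs s
  have h3 : ∑ x, z ^ d x ≤ Fintype.card ι • (1 : ℝ) := by
    rw [← Finset.card_univ]
    exact Finset.sum_le_card_nsmul _ _ _ fun x _ => Real.rpow_le_one hz.le hz1 (hd x).le
  simp only [nsmul_eq_mul, mul_one] at h1 h3
  linarith

theorem finite_setOf_lt {ι ρ : Type*} [Fintype ι] {d : ι → ℝ} (hd : ∀ x, 0 < d x)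
    {e : ρ → ℝ} {z : ℝ} (hz : 0 < z) (hz1 : z ≤ 1) (hs : Summable fun r => z ^ e r)
    (hf : 1 - ∑ x, z ^ d x + ∑' r, z ^ e r < 0) (T : ℝ) : {r | e r < T}.Finite := by
  by_contra hinf
  obtain ⟨n, hn⟩ := exists_nat_gt (Fintype.card ι / z ^ T)
  obtain ⟨s, hs1, hs2⟩ := Set.Infinite.exists_subset_card_eq hinf n
  have := card_mul_rpow_le hd hz hz1 hs hf s fun r hr => hs1 hr
  rw [div_lt_iff₀ (Real.rpow_pos_of_pos hz T), ← hs2] at hn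
  linarith

/-- The compactness argument behind the passage to the limit. Given infinitely many
Golod–Shafarevich presentations on the same generators, there is one `q < 1` such that, for every
`T`, infinitely many of them satisfy `f ≤ 0` at a point of `(0, q]` once the relations of degree
at least `T` are dropped. If the given points `z j` accumulate only at `1`, then the number of
relations of degree less than `T` is bounded, independently of `T`; as the possible degrees are
discrete, the relations of bounded degree contribute the same function of `z` for a large set of
`j`, and a function which is negative at a point of `(0, 1]` is so at a point of `(0, 1)`. -/
theorem exists_lt_one_frequently_truncated {ι : Type*} [Fintype ι] {d : ι → ℝ}
    (hd : ∀ x, 0 < d x) {ρ : ℕ → Type*} (e : ∀ j, ρ j → ℝ) {Δ : Set ℝ}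
    (hΔ : ∀ T, (Δ ∩ Set.Iio T).Finite) (he : ∀ j r, e j r ∈ Δ) (z : ℕ → ℝ)
    (hz : ∀ j, 0 < z j) (hz1 : ∀ j, z j ≤ 1) (hs : ∀ j, Summable fun r => z j ^ e j r)
    (hf : ∀ j, 1 - ∑ x, z j ^ d x + ∑' r, z j ^ e j r < 0) :
    ∃ q < (1 : ℝ), ∀ T : ℝ, ∃ᶠ j in atTop, ∃ s : Finset (ρ j), (∀ r, r ∈ s ↔ e j r < T) ∧
      ∃ y : ℝ, 0 < y ∧ y ≤ q ∧ 1 - ∑ x, y ^ d x + ∑ r ∈ s, y ^ e j r ≤ 0 := by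
  classical
  have hfin : ∀ j T, {r | e j r < T}.Finite := fun j T =>
    finite_setOf_lt hd (hz j) (hz1 j) (hs j) (hf j) T
  by_cases hA : ∃ q < (1 : ℝ), ∃ᶠ j in atTop, z j ≤ q
  · obtain ⟨q, hq, hfr⟩ := hA
    refine ⟨q, hq, fun T => hfr.mono fun j hj => ⟨(hfin j T).toFinset, by simp, z j, hz j, hj, ?_⟩⟩
    linarith [hf j, sum_rpow_le_tsum (hz j).le (hs j) (hfin j T).toFinset]
  push Not at hA
  set N : ℝ → ℕ → ℕ := fun T j => (hfin j T).toFinset.card with hN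
  have hNmono : ∀ j {T T'}, T ≤ T' → (hfin j T).toFinset ⊆ (hfin j T').toFinset := by
    intro j T T' h r hr
    simp only [Set.Finite.mem_toFinset, Set.mem_ofPred_eq] at hr ⊢
    linarith
  -- For large `j` the point `z j` is so close to `1` that `z j ^ T` is at least `1 / 2`.
  have hbound : ∀ T, ∀ᶠ j in atTop, N T j ≤ 2 * Fintype.card ι := by
    intro T
    have h0 : Tendsto (fun y : ℝ => y ^ T) (nhds 1) (nhds 1) := by
      simpa using (Real.continuousAt_rpow_const 1 T (Or.inl one_ne_zero)).tendsto
    obtain ⟨δ, hδ, hδ'⟩ := Metric.eventually_nhds_iff.1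
      (h0.eventually (lt_mem_nhds one_half_lt_one))
    filter_upwards [hA (1 - δ) (by linarith)] with j hj
    have h1 : 1 / 2 < z j ^ T := hδ' (by
      rw [Real.dist_eq, abs_lt]; constructor <;> linarith [hz1 j])
    have h2 := card_mul_rpow_le hd (hz j) (hz1 j) (hs j) (hf j) (T := T) (hfin j T).toFinset
      fun r hr => by simpa using hr
    have h3 : (N T j : ℝ) * (1 / 2) ≤ N T j * z j ^ T :=
      mul_le_mul_of_nonneg_left h1.le (Nat.cast_nonneg _)
    have h4 : (N T j : ℝ) ≤ 2 * Fintype.card ι := by linarith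
    exact_mod_cast h4
  let 𝒰 := hyperfilter ℕ
  have h𝒰 : (𝒰 : Filter ℕ) ≤ atTop := Nat.hyperfilter_le_atTop
  have hconst : ∀ T, ∃ m ≤ 2 * Fintype.card ι, ∀ᶠ j in 𝒰, N T j = m := by
    intro T
    have h1 : (⋃ m ∈ Set.Iic (2 * Fintype.card ι), {j | N T j = m}) ∈ 𝒰 := by
      filter_upwards [h𝒰 (hbound T)] with j hj
      simpa using hj
    rw [Ultrafilter.finite_biUnion_mem_iff (Set.finite_Iic _)] at h1
    exact h1
  choose m hm hm' using hconst
  obtain ⟨T₀, hT₀⟩ : ∃ T₀, ∀ T, m T ≤ m T₀ := by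
    have hb : BddAbove (Set.range m) := ⟨_, by rintro _ ⟨T, rfl⟩; exact hm T⟩
    obtain ⟨T₀, h⟩ := Nat.sSup_mem (Set.range_nonempty m) hb
    exact ⟨T₀, fun T => h ▸ le_csSup hb ⟨T, rfl⟩⟩
  -- Along the ultrafilter there are no relations of degree in `[T₀, T)`, and the degrees below
  -- `T₀` are constant.
  have : Finite ↥(Δ ∩ Set.Iio T₀) := (hΔ T₀).to_subtype
  obtain ⟨δ, hδ⟩ : ∃ δ : Fin (m T₀) → ↥(Δ ∩ Set.Iio T₀), ∀ᶠ j in 𝒰,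
      ∀ y : ℝ, ∑ r ∈ (hfin j T₀).toFinset, y ^ e j r = ∑ i, y ^ (δ i : ℝ) := by
    have h1 : (⋃ δ ∈ (Set.univ : Set (Fin (m T₀) → ↥(Δ ∩ Set.Iio T₀))), {j | ∀ y : ℝ,
        ∑ r ∈ (hfin j T₀).toFinset, y ^ e j r = ∑ i, y ^ (δ i : ℝ)}) ∈ 𝒰 := by
      filter_upwards [hm' T₀] with j hj
      let E := (hfin j T₀).toFinset.equivFinOfCardEq hj
      simp only [Set.mem_univ, Set.iUnion_true, Set.mem_iUnion, Set.mem_ofPred_eq]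
      refine ⟨fun i => ⟨e j (E.symm i), he j _, (hfin j T₀).mem_toFinset.1 (E.symm i).2⟩,
        fun y => ?_⟩
      rw [← Finset.sum_coe_sort]
      exact (Equiv.sum_comp E.symm fun r => y ^ e j r).symm
    rw [Ultrafilter.finite_biUnion_mem_iff Set.finite_univ] at h1
    obtain ⟨δ, -, h2⟩ := h1
    exact ⟨δ, h2⟩
  set h : ℝ → ℝ := fun y => 1 - ∑ x, y ^ d x + ∑ i, y ^ (δ i : ℝ) with hh
  obtain ⟨y, hy0, hy1, hhy⟩ : ∃ y, 0 < y ∧ y < 1 ∧ h y ≤ 0 := by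
    obtain ⟨j, hj⟩ := hδ.exists
    have h1 : h (z j) < 0 := by
      have := sum_rpow_le_tsum (hz j).le (hs j) (hfin j T₀).toFinset
      rw [hj] at this
      linarith [hf j]
    have hcont : ContinuousAt h (z j) := by
      have : ∀ c : ℝ, ContinuousAt (fun y : ℝ => y ^ c) (z j) := fun c =>
        Real.continuousAt_rpow_const _ _ (Or.inl (hz j).ne')
      exact (continuousAt_const.sub (tendsto_finsetSum _ fun x _ => this _)).add
        (tendsto_finsetSum _ fun i _ => this _)
    obtain ⟨ε, hε, hε'⟩ := Metric.eventually_nhds_iff.1 (hcont.eventually (gt_mem_nhds h1))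
    have h2 : 0 < min (ε / 2) (z j / 2) := lt_min (by linarith) (by linarith [hz j])
    refine ⟨z j - min (ε / 2) (z j / 2), ?_, ?_, (hε' ?_).le⟩
    · linarith [min_le_right (ε / 2) (z j / 2), hz j]
    · linarith [hz1 j]
    · rw [Real.dist_eq, abs_lt]
      constructor <;> linarith [min_le_left (ε / 2) (z j / 2)]
  refine ⟨y, hy1, fun T => ?_⟩
  have hev : ∀ᶠ j in 𝒰, (hfin j (max T T₀)).toFinset = (hfin j T₀).toFinset := by
    filter_upwards [hm' (max T T₀), hm' T₀] with j h1 h2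
    refine (Finset.eq_of_subset_of_card_le (hNmono j (le_max_right _ _)) ?_).symm
    exact (h1.trans_le (hT₀ _)).trans h2.ge
  refine Filter.Frequently.filter_mono (Eventually.frequently ?_) h𝒰
  filter_upwards [hev, hδ] with j h1 h2
  refine ⟨(hfin j T).toFinset, by simp, y, hy0, le_rfl, ?_⟩
  have h3 : ∑ r ∈ (hfin j T).toFinset, y ^ e j r ≤ ∑ r ∈ (hfin j T₀).toFinset, y ^ e j r := by
    rw [← h1]
    exact Finset.sum_le_sum_of_subset_of_nonneg (hNmono j (le_max_left _ _))
      fun _ _ _ => Real.rpow_nonneg hy0.le _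
  rw [h2] at h3
  linarith

end Truncation

end GolodShafarevich

/-! ### Coefficients of noncommutative power series -/

namespace NCPowerSeries

variable {k ι : Type*} [Field k]

theorem algebraMap_nil (c : k) : algebraMap k (NCPowerSeries k ι) c [] = c := by
  rw [Algebra.algebraMap_eq_smul_one, smul_apply, one_nil, mul_one]

theorem algebraMap_cons (c : k) (x : ι) (w : List ι) :
    algebraMap k (NCPowerSeries k ι) c (x :: w) = 0 := by
  rw [Algebra.algebraMap_eq_smul_one, smul_apply, one_cons, mul_zero]

theorem sum_apply {κ : Type*} (s : Finset κ) (f : κ → NCPowerSeries k ι) (w : List ι) :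
    (∑ i ∈ s, f i) w = ∑ i ∈ s, f i w :=
  Finset.sum_apply w s f

theorem sub_apply (f g : NCPowerSeries k ι) (w : List ι) : (f - g) w = f w - g w := rfl

theorem X_nil (x : ι) : (X x : NCPowerSeries k ι) [] = 0 := by
  simp [X]

theorem mul_X_nil (f : NCPowerSeries k ι) (x : ι) : (f * X x : NCPowerSeries k ι) [] = 0 := by
  rw [mul_nil, X_nil, mul_zero]

open Classical in
theorem mul_X_append (f : NCPowerSeries k ι) (x y : ι) (w : List ι) :
    (f * X x : NCPowerSeries k ι) (w ++ [y]) = if y = x then f w else 0 := by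
  induction w generalizing f with
  | nil => simp [mul_cons, mul_X_nil, X]
  | cons v w ih =>
    rw [List.cons_append, mul_cons, ih]
    have : (X x : NCPowerSeries k ι) (v :: (w ++ [y])) = 0 := by simp [X]
    rw [this, mul_zero, add_zero]
    rfl

open Classical in
theorem X_mul_cons (f : NCPowerSeries k ι) (x y : ι) (w : List ι) :
    (X x * f : NCPowerSeries k ι) (y :: w) = if y = x then f w else 0 := by
  have h : shift y (X x : NCPowerSeries k ι) = if y = x then 1 else 0 := by
    ext w
    by_cases hy : y = x
    · subst hy
      cases w <;> simp [shift, X, one_nil, one_cons]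
    · simp [shift, X, hy, zero_apply]
  rw [mul_cons, h, X_nil, zero_mul, add_zero]
  by_cases hy : y = x <;> simp [hy, zero_apply]

end NCPowerSeries

namespace GolodShafarevich

/-! ### Degrees of words -/

section Words

variable {ι : Type*} {d : ι → ℝ}

theorem wordDegree_nil : wordDegree d [] = 0 := rfl

theorem wordDegree_append (u v : List ι) :
    wordDegree d (u ++ v) = wordDegree d u + wordDegree d v := by
  simp [wordDegree]

theorem wordDegree_singleton (x : ι) : wordDegree d [x] = d x := by
  simp [wordDegree]

theorem length_mul_le_wordDegree {δ : ℝ} (h : ∀ x, δ ≤ d x) (w : List ι) :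
    w.length * δ ≤ wordDegree d w := by
  induction w with
  | nil => simp [wordDegree]
  | cons x w ih =>
    have : wordDegree d (x :: w) = d x + wordDegree d w := by simp [wordDegree]
    rw [this, List.length_cons]
    push_cast
    linarith [h x]

theorem wordDegree_nonneg (hd : ∀ x, 0 < d x) (w : List ι) : 0 ≤ wordDegree d w := by
  simpa using length_mul_le_wordDegree (fun x => (hd x).le) w

theorem exists_pos_le [Finite ι] (hd : ∀ x, 0 < d x) : ∃ δ, 0 < δ ∧ ∀ x, δ ≤ d x := by
  cases isEmpty_or_nonempty ι
  · exact ⟨1, one_pos, isEmptyElim⟩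
  · obtain ⟨x, hx⟩ := Finite.exists_min d
    exact ⟨d x, hd x, hx⟩

theorem finite_setOf_wordDegree_lt [Finite ι] (hd : ∀ x, 0 < d x) (t : ℝ) :
    {w | wordDegree d w < t}.Finite := by
  obtain ⟨δ, hδ, h⟩ := exists_pos_le hd
  obtain ⟨n, hn⟩ := exists_nat_gt (t / δ)
  refine (List.finite_length_lt ι n).subset fun w hw => ?_
  have h1 : (w.length : ℝ) * δ < n * δ :=
    (length_mul_le_wordDegree h w).trans_lt (hw.trans ((div_lt_iff₀ hδ).1 hn))
  exact_mod_cast lt_of_mul_lt_mul_right h1 hδ.le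

theorem finite_range_wordDegree_inter_Iio [Finite ι] (hd : ∀ x, 0 < d x) (t : ℝ) :
    (Set.range (wordDegree d) ∩ Set.Iio t).Finite := by
  refine ((finite_setOf_wordDegree_lt hd t).image (wordDegree d)).subset ?_
  rintro _ ⟨⟨w, rfl⟩, hw⟩
  exact ⟨w, hw, rfl⟩

variable {k : Type*} [Field k]

theorem exists_wordDegree_eq_degree [Finite ι] (hd : ∀ x, 0 < d x) {a : List ι → k}
    (ha : ∃ w, a w ≠ 0) : ∃ w, a w ≠ 0 ∧ wordDegree d w = degree d a ∧
      ∀ v, wordDegree d v < degree d a → a v = 0 := by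
  obtain ⟨w₀, hw₀⟩ := ha
  obtain ⟨w, ⟨hw, hw'⟩, hmin⟩ := Set.exists_min_image
    {w | a w ≠ 0 ∧ wordDegree d w < wordDegree d w₀ + 1} (wordDegree d)
    ((finite_setOf_wordDegree_lt hd _).subset fun _ h => h.2)
    ⟨w₀, hw₀, by simp⟩
  have hl : IsLeast {t | ∃ w, a w ≠ 0 ∧ t = wordDegree d w} (wordDegree d w) := by
    refine ⟨⟨w, hw, rfl⟩, ?_⟩
    rintro _ ⟨v, hv, rfl⟩
    by_cases h : wordDegree d v < wordDegree d w₀ + 1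
    · exact hmin v ⟨hv, h⟩
    · have hlt : wordDegree d w < wordDegree d w₀ + 1 := hw'
      linarith
  have hdeg : degree d a = wordDegree d w := hl.csInf_eq
  refine ⟨w, hw, hdeg.symm, fun v hv => ?_⟩
  by_contra h
  exact (hl.2 ⟨v, h, rfl⟩).not_gt (hdeg ▸ hv)

end Words

/-! ### The degree filtration and the Golod–Shafarevich inequality -/

/-- The common features of `k⟨ι⟩` and `k⟪ι⟫`: an algebra with a homomorphism to `k⟪ι⟫` giving
the coefficients of its elements, and with generators `gen x` mapping to the variables, such that
every element is a constant plus a left combination of the generators. -/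
structure WordAlgebra (k ι F : Type*) [Field k] [Fintype ι] [Ring F] [Algebra k F] where
  /-- The coefficients of an element. -/
  coeff : F →ₐ[k] NCPowerSeries k ι
  /-- The generators. -/
  gen : ι → F
  coeff_gen : ∀ x, coeff (gen x) = NCPowerSeries.X x
  exists_eq : ∀ f, ∃ u : ι → F, f = algebraMap k F (coeff f []) + ∑ x, u x * gen x

namespace WordAlgebra

variable {k ι F : Type*} [Field k] [Fintype ι] [Ring F] [Algebra k F] (W : WordAlgebra k ι F)
  {d : ι → ℝ}

/-- The elements all of whose words have degree at least `t`. -/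
noncomputable def degGE (d : ι → ℝ) (t : ℝ) : Submodule k F where
  carrier := {f | ∀ w, wordDegree d w < t → W.coeff f w = 0}
  add_mem' {f g} hf hg w hw := by
    rw [map_add, NCPowerSeries.add_apply, hf w hw, hg w hw, add_zero]
  zero_mem' w _ := by rw [map_zero]; rfl
  smul_mem' c f hf w hw := by rw [map_smul, NCPowerSeries.smul_apply, hf w hw, mul_zero]

/-- The elements all of whose words have length at least `n`. -/
noncomputable def lenGE (n : ℕ) : Submodule k F :=
  (NCPowerSeries.lengthFiltration k ι n).comap W.coeff.toLinearMap

theorem mem_degGE {t : ℝ} {f : F} :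
    f ∈ W.degGE d t ↔ ∀ w, wordDegree d w < t → W.coeff f w = 0 := Iff.rfl

theorem mem_lenGE {n : ℕ} {f : F} :
    f ∈ W.lenGE n ↔ ∀ w : List ι, w.length < n → W.coeff f w = 0 := Iff.rfl

theorem degGE_anti {s t : ℝ} (h : s ≤ t) : W.degGE d t ≤ W.degGE d s :=
  fun _ hf w hw => hf w (hw.trans_le h)

theorem degGE_eq_top (hd : ∀ x, 0 < d x) {t : ℝ} (ht : t ≤ 0) : W.degGE d t = ⊤ :=
  eq_top_iff.2 fun _ _ w hw => absurd (hw.trans_le ht) (wordDegree_nonneg hd w).not_gt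

theorem lenGE_le_degGE {δ : ℝ} (hδ : 0 ≤ δ) (h : ∀ x, δ ≤ d x) {n : ℕ} {t : ℝ}
    (ht : t ≤ n * δ) : W.lenGE n ≤ W.degGE d t := by
  intro f hf w hw
  refine hf w ?_
  by_contra hn
  have h1 : (n : ℝ) * δ ≤ w.length * δ :=
    mul_le_mul_of_nonneg_right (by exact_mod_cast not_lt.1 hn) hδ
  linarith [length_mul_le_wordDegree h w]

theorem mul_mem_degGE {s t : ℝ} {f g : F} (hf : f ∈ W.degGE d s) (hg : g ∈ W.degGE d t) :
    f * g ∈ W.degGE d (s + t) := by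
  intro w hw
  rw [map_mul, NCPowerSeries.mul_apply]
  refine Finset.sum_eq_zero fun i _ => ?_
  have h : wordDegree d (w.take i) + wordDegree d (w.drop i) = wordDegree d w := by
    rw [← wordDegree_append, List.take_append_drop]
  rcases lt_or_ge (wordDegree d (w.take i)) s with h1 | h1
  · rw [hf _ h1, zero_mul]
  · rw [hg _ (by linarith), mul_zero]

theorem mul_mem_degGE_left (hd : ∀ x, 0 < d x) {t : ℝ} (f : F) {g : F} (hg : g ∈ W.degGE d t) :
    f * g ∈ W.degGE d t := by
  have hf : f ∈ W.degGE d 0 := by rw [W.degGE_eq_top hd le_rfl]; trivial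
  simpa using W.mul_mem_degGE hf hg

theorem gen_mem_degGE (x : ι) : W.gen x ∈ W.degGE d (d x) := by
  intro w hw
  rw [W.coeff_gen]
  have : w ≠ [x] := by rintro rfl; simp [wordDegree_singleton] at hw
  simp [NCPowerSeries.X, this]

theorem coeff_sum_mul_gen_append (u : ι → F) (x : ι) (w : List ι) :
    W.coeff (∑ y, u y * W.gen y) (w ++ [x]) = W.coeff (u x) w := by
  classical
  have h : ∀ y, W.coeff (u y * W.gen y) (w ++ [x]) = if x = y then W.coeff (u y) w else 0 :=
    fun y => by rw [map_mul, W.coeff_gen, NCPowerSeries.mul_X_append]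
  rw [map_sum, NCPowerSeries.sum_apply, Finset.sum_congr rfl fun y _ => h y]
  simp

theorem coeff_sum_mul_gen_nil (u : ι → F) : W.coeff (∑ y, u y * W.gen y) [] = 0 := by
  rw [map_sum, NCPowerSeries.sum_apply]
  exact Finset.sum_eq_zero fun y _ => by
    rw [map_mul, W.coeff_gen, NCPowerSeries.mul_X_nil]

theorem mem_degGE_of_sum_mul_gen_mem {u : ι → F} {t : ℝ}
    (h : ∑ y, u y * W.gen y ∈ W.degGE d t) (x : ι) : u x ∈ W.degGE d (t - d x) := by
  intro w hw
  rw [← W.coeff_sum_mul_gen_append]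
  refine h _ ?_
  rw [wordDegree_append, wordDegree_singleton]
  linarith

theorem finite_quotient (hd : ∀ x, 0 < d x) (t : ℝ) (I : Submodule k F) :
    Module.Finite k (F ⧸ I ⊔ W.degGE d t) := by
  have := (finite_setOf_wordDegree_lt hd t).to_subtype
  let ev : F →ₗ[k] ({w | wordDegree d w < t} → k) :=
    { toFun := fun f w => W.coeff f w
      map_add' := fun f g => by ext w; simp [NCPowerSeries.add_apply]
      map_smul' := fun c f => by ext w; simp [NCPowerSeries.smul_apply] }
  have hker : LinearMap.ker ev ≤ I ⊔ W.degGE d t := by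
    intro f hf
    exact Submodule.mem_sup_right fun w hw => congr_fun (LinearMap.mem_ker.1 hf) ⟨w, hw⟩
  have : Module.Finite k (F ⧸ LinearMap.ker ev) :=
    Module.Finite.equiv (LinearMap.quotKerEquivRange ev).symm
  exact Module.Finite.of_surjective (Submodule.factor hker) (Submodule.factor_surjective hker)

/-- The two-sided ideal generated by `R`, as a subspace. -/
def ideal (R : Set F) : Submodule k F :=
  (TwoSidedIdeal.asIdeal (TwoSidedIdeal.span R)).restrictScalars k

theorem mem_ideal {R : Set F} {f : F} : f ∈ ideal (k := k) R ↔ f ∈ TwoSidedIdeal.span R :=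
  TwoSidedIdeal.mem_asIdeal

theorem mul_mem_ideal_right {R : Set F} {f : F} (hf : f ∈ ideal (k := k) R) (g : F) :
    f * g ∈ ideal (k := k) R :=
  mem_ideal.2 (TwoSidedIdeal.mul_mem_right _ _ _ (mem_ideal.1 hf))

open scoped Pointwise in
/-- As `b = b₀ + ∑ b_x x`, an element `a r b` of the two-sided ideal `(R)` is `b₀ a r` plus an
element of `∑ (R) x`: this gives `(R) = F R + ∑ (R) x`. -/
theorem ideal_le {R : Set F} {M : Submodule k F} (h1 : ∀ f, ∀ r ∈ R, f * r ∈ M)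
    (h2 : ∀ f ∈ ideal (k := k) R, ∀ x, f * W.gen x ∈ M) : ideal (k := k) R ≤ M := by
  intro f hf
  rw [mem_ideal, TwoSidedIdeal.mem_span_iff_mem_addSubgroup_closure] at hf
  suffices AddSubgroup.closure (Set.univ * R * Set.univ) ≤ M.toAddSubgroup from this hf
  rw [AddSubgroup.closure_le]
  rintro _ ⟨_, ⟨a, -, r, hr, rfl⟩, b, -, rfl⟩
  obtain ⟨u, hu⟩ := W.exists_eq b
  have har : a * r ∈ ideal (k := k) R :=
    mem_ideal.2 (TwoSidedIdeal.mul_mem_left _ _ _ (TwoSidedIdeal.subset_span hr))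
  change a * r * b ∈ M
  rw [hu, mul_add, Finset.mul_sum]
  refine M.add_mem ?_ (M.sum_mem fun x _ => ?_)
  · rw [← Algebra.commutes, ← Algebra.smul_def]
    exact M.smul_mem _ (h1 a r hr)
  · rw [← mul_assoc]
    exact h2 _ (mul_mem_ideal_right har _) x

/-- The Golod–Shafarevich inequality for the dimensions of `A / A_{≥ t}`, where `A = F / (R)`,
from the complex `⨁_{r ∈ R} A → ⨁_x A → A → k`, which is exact at `⨁_x A`; its first map sends
`1` in the copy `r` to `(r_x)_x`, where `r = ∑ r_x x`, and its second map sends `(f_x)_x` to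
`∑ f_x x`. Modulo degrees at least `t` only the relations of degree less than `t` contribute. -/
theorem gs_inequality (hd : ∀ x, 0 < d x) {R : Set F} (hR : ∀ r ∈ R, W.coeff r [] = 0)
    {e : F → ℝ} (he : ∀ r ∈ R, r ∈ W.degGE d (e r)) {t : ℝ} (ht : 0 < t) (s : Finset R)
    (hs : ∀ r : R, e r < t → r ∈ s) :
    1 + ∑ x, Module.finrank k (F ⧸ ideal (k := k) R ⊔ W.degGE d (t - d x)) ≤
      Module.finrank k (F ⧸ ideal (k := k) R ⊔ W.degGE d t) +
        ∑ r ∈ s, Module.finrank k (F ⧸ ideal (k := k) R ⊔ W.degGE d (t - e r)) := by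
  classical
  set J : Submodule k F := ideal (k := k) R with hJ
  have : ∀ t, Module.Finite k (F ⧸ J ⊔ W.degGE d t) := fun t => W.finite_quotient hd t J
  have hdec : ∀ r : R, ∃ u : ι → F, (r : F) = ∑ x, u x * W.gen x := fun r => by
    obtain ⟨u, hu⟩ := W.exists_eq r
    exact ⟨u, by rwa [hR r r.2, map_zero, zero_add] at hu⟩
  choose ρ hρ using hdec
  have hρdeg : ∀ (r : R) x, ρ r x ∈ W.degGE d (e r - d x) := fun r x =>
    W.mem_degGE_of_sum_mul_gen_mem (hρ r ▸ he r r.2) x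
  -- The complex modulo degrees at least `t`.
  let α (r : R) : (F ⧸ J ⊔ W.degGE d (t - e r)) →ₗ[k] ∀ x, F ⧸ J ⊔ W.degGE d (t - d x) :=
    LinearMap.pi fun x => Submodule.mapQ _ _ (LinearMap.mulRight k (ρ r x)) (by
      rw [sup_le_iff]
      refine ⟨fun f hf => Submodule.mem_sup_left (mul_mem_ideal_right hf _),
        fun f hf => Submodule.mem_sup_right ?_⟩
      have := W.mul_mem_degGE hf (hρdeg r x)
      rwa [sub_add_sub_cancel] at this)
  let αs : (∀ r : s, F ⧸ J ⊔ W.degGE d (t - e r.1)) →ₗ[k] ∀ x, F ⧸ J ⊔ W.degGE d (t - d x) :=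
    ∑ r : s, (α r.1).comp (LinearMap.proj r)
  let β : (∀ x, F ⧸ J ⊔ W.degGE d (t - d x)) →ₗ[k] F ⧸ J ⊔ W.degGE d t :=
    ∑ x, (Submodule.mapQ _ _ (LinearMap.mulRight k (W.gen x)) (by
      rw [sup_le_iff]
      refine ⟨fun f hf => Submodule.mem_sup_left (mul_mem_ideal_right hf _),
        fun f hf => Submodule.mem_sup_right ?_⟩
      have := W.mul_mem_degGE hf (W.gen_mem_degGE (d := d) x)
      rwa [sub_add_cancel] at this)).comp (LinearMap.proj x)
  let cl : (ι → F) →ₗ[k] ∀ x, F ⧸ J ⊔ W.degGE d (t - d x) :=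
    LinearMap.pi fun x => (Submodule.mkQ _).comp (LinearMap.proj x)
  let μ : (ι → F) →ₗ[k] F := ∑ x, (LinearMap.mulRight k (W.gen x)).comp (LinearMap.proj x)
  have hμ : ∀ u, μ u = ∑ x, u x * W.gen x := fun u => by simp [μ]
  have hβ : ∀ u, β (cl u) = Submodule.Quotient.mk (∑ x, u x * W.gen x) := fun u => by
    simp only [β, cl, LinearMap.sum_apply, LinearMap.comp_apply, LinearMap.proj_apply,
      LinearMap.pi_apply, Submodule.mkQ_apply, Submodule.mapQ_apply, LinearMap.mulRight_apply]
    exact (map_sum (Submodule.mkQ (J ⊔ W.degGE d t)) _ _).symm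
  have hcl : Function.Surjective cl := fun v => by
    choose u hu using fun x => Submodule.mkQ_surjective _ (v x)
    exact ⟨u, funext hu⟩
  have hJM : J ≤ Submodule.map μ (Submodule.comap cl (LinearMap.range αs)) := by
    refine W.ideal_le (fun f r hr => ?_) fun f hf x => ?_
    · refine ⟨fun x => f * ρ ⟨r, hr⟩ x, ?_, ?_⟩
      · change cl _ ∈ LinearMap.range αs
        by_cases hrs : (⟨r, hr⟩ : R) ∈ s
        · refine ⟨Pi.single ⟨_, hrs⟩ (Submodule.Quotient.mk f), ?_⟩
          simp only [αs, LinearMap.sum_apply, LinearMap.comp_apply, LinearMap.proj_apply]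
          rw [Finset.sum_eq_single ⟨_, hrs⟩ (fun b _ hb => by
            rw [Pi.single_eq_of_ne hb, map_zero]) (by simp), Pi.single_eq_same]
          rfl
        · convert (LinearMap.range αs).zero_mem
          ext x
          refine (Submodule.Quotient.mk_eq_zero _).2 (Submodule.mem_sup_right ?_)
          refine W.mul_mem_degGE_left hd f (W.degGE_anti ?_ (hρdeg ⟨r, hr⟩ x))
          have : ¬ e r < t := fun h => hrs (hs ⟨r, hr⟩ h)
          dsimp only
          linarith
      · rw [hμ]
        conv_rhs => rw [show r = ((⟨r, hr⟩ : R) : F) from rfl, hρ ⟨r, hr⟩, Finset.mul_sum]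
        simp only [mul_assoc]
    · refine ⟨Pi.single x f, ?_, ?_⟩
      · change cl _ ∈ LinearMap.range αs
        convert (LinearMap.range αs).zero_mem
        ext y
        refine (Submodule.Quotient.mk_eq_zero _).2 (Submodule.mem_sup_left ?_)
        by_cases hy : y = x
        · subst hy; simpa using hf
        · simp [hy]
      · rw [hμ, Finset.sum_eq_single x (fun y _ hy => by simp [hy]) (by simp), Pi.single_eq_same]
  have hker : LinearMap.ker β ≤ LinearMap.range αs := by
    intro v hv
    obtain ⟨f, rfl⟩ := hcl v
    rw [LinearMap.mem_ker, hβ, Submodule.Quotient.mk_eq_zero] at hv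
    obtain ⟨j, hj, h, hh, hjh⟩ := Submodule.mem_sup.1 hv
    obtain ⟨u, hu, rfl⟩ := hJM hj
    have h1 : cl (f - u) = 0 := by
      ext x
      refine (Submodule.Quotient.mk_eq_zero _).2 (Submodule.mem_sup_right ?_)
      refine W.mem_degGE_of_sum_mul_gen_mem (u := f - u) ?_ x
      simp only [Pi.sub_apply, sub_mul, Finset.sum_sub_distrib]
      rw [← hjh, hμ, add_sub_cancel_left]
      exact hh
    rw [map_sub, sub_eq_zero] at h1
    rw [h1]
    exact hu
  -- No element of `(R)`, of `∑ F x` or of positive degree has a constant term.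
  have hrange : LinearMap.range β ≠ ⊤ := by
    intro htop
    obtain ⟨v, hv⟩ := LinearMap.range_eq_top.1 htop (Submodule.Quotient.mk 1)
    obtain ⟨u, rfl⟩ := hcl v
    rw [hβ, Submodule.Quotient.eq] at hv
    obtain ⟨j, hj, h, hh, hjh⟩ := Submodule.mem_sup.1 hv
    obtain ⟨u', -, rfl⟩ := hJM hj
    have h1 := congr_arg (fun f => W.coeff f []) hjh
    simp only [hμ, map_add, map_sub, map_one, NCPowerSeries.add_apply, NCPowerSeries.sub_apply,
      W.coeff_sum_mul_gen_nil, hh [] (by simpa [wordDegree_nil] using ht),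
      NCPowerSeries.one_nil] at h1
    norm_num at h1
  have e1 := Submodule.finrank_lt hrange
  have e2 := LinearMap.finrank_range_add_finrank_ker β
  have e3 := Submodule.finrank_mono hker
  have e4 := LinearMap.finrank_range_le αs
  rw [Module.finrank_pi_fintype] at e2 e4
  rw [Finset.sum_coe_sort s fun r : R =>
    Module.finrank k (F ⧸ J ⊔ W.degGE d (t - e r))] at e4
  omega

theorem lenGE_eq_degGE (n : ℕ) : W.lenGE n = W.degGE (fun _ => 1) n := by
  ext f
  rw [mem_lenGE, mem_degGE]
  simp [wordDegree]

theorem finite_quotient_lenGE (n : ℕ) (I : Submodule k F) :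
    Module.Finite k (F ⧸ I ⊔ W.lenGE n) := by
  rw [lenGE_eq_degGE]
  exact W.finite_quotient (fun _ => one_pos) n I

/-! ### Exponential growth of the limit ideal -/

theorem finrank_quotient_anti {M N : Submodule k F} [Module.Finite k (F ⧸ M)] (h : M ≤ N) :
    Module.finrank k (F ⧸ N) ≤ Module.finrank k (F ⧸ M) :=
  LinearMap.finrank_le_finrank_of_surjective (Submodule.factor_surjective h)

theorem exists_forall_sup_degGE_eq (hd : ∀ x, 0 < d x) {I : ℕ → Submodule k F} (hI : Monotone I)
    (T : ℝ) : ∃ j₀, ∀ j ≥ j₀, ∀ t ≤ T, I j ⊔ W.degGE d t = (⨆ i, I i) ⊔ W.degGE d t := by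
  have hfin : Module.Finite k (F ⧸ W.degGE d T) := by
    have h := W.finite_quotient hd T ⊥
    rwa [bot_sup_eq] at h
  let f : ℕ →o Submodule k (F ⧸ W.degGE d T) :=
    ⟨fun j => (I j).map (W.degGE d T).mkQ, fun i j h => Submodule.map_mono (hI h)⟩
  obtain ⟨j₀, hj₀⟩ := monotone_stabilizes_iff_noetherian.2
    (inferInstance : IsNoetherian k (F ⧸ W.degGE d T)) f
  have hsup : ∀ j ≥ j₀, (⨆ i, I i).map (W.degGE d T).mkQ = f j := by
    intro j hj
    rw [Submodule.map_iSup, ← hj₀ j hj]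
    refine le_antisymm (iSup_le fun i => ?_) (le_iSup (fun i => (I i).map _) j₀)
    rcases le_total i j₀ with h | h
    · exact f.monotone h
    · exact (hj₀ i h).ge
  refine ⟨j₀, fun j hj t ht => ?_⟩
  have h1 : I j ⊔ W.degGE d T = (⨆ i, I i) ⊔ W.degGE d T := by
    have h := congr_arg (Submodule.comap (W.degGE d T).mkQ) (hsup j hj)
    change _ = Submodule.comap (W.degGE d T).mkQ ((I j).map (W.degGE d T).mkQ) at h
    rw [Submodule.comap_map_mkQ, Submodule.comap_map_mkQ] at h
    rw [sup_comm, ← h, sup_comm]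
  rw [← sup_eq_right.2 (W.degGE_anti ht), ← sup_assoc, h1, sup_assoc]

/-- Exponential growth of the limit, in terms of ideals. All dimensions of
`A / A_{≥ t}` with `t ≤ T` are attained at a finite stage `j`, which may be chosen with truncated
`f ≤ 0` at a point of `(0, q]`; so the Golod–Shafarevich inequality there bounds the dimension
for `T` itself from below by a constant times `q ^ (-T)`. -/
theorem exists_pow_le_finrank (hd : ∀ x, 0 < d x) {I : ℕ → Submodule k F} (hI : Monotone I)
    (R : ℕ → Set F) (hR : ∀ j, ∀ r ∈ R j, (∃ w, W.coeff r w ≠ 0) ∧ W.coeff r [] = 0)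
    (hRI : ∀ j, ideal (R j) ≤ I j) (hIR : ∀ j n, I j ≤ ideal (R j) ⊔ W.lenGE n)
    (z : ℕ → ℝ) (hz : ∀ j, z j ∈ Set.Icc (0 : ℝ) 1)
    (hs : ∀ j, SeriesConverges d (fun (r : F) (w : List ι) => W.coeff r w) (R j) (z j))
    (hf : ∀ j, seriesValue d (fun (r : F) (w : List ι) => W.coeff r w) (R j) (z j) < 0) :
    ∃ c : ℝ, 1 < c ∧ ∀ᶠ n : ℕ in atTop,
      c ^ n ≤ Module.finrank k (F ⧸ (⨆ j, I j) ⊔ W.lenGE n) := by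
  have hz0 : ∀ j, 0 < z j := by
    intro j
    refine (hz j).1.lt_of_ne' fun h0 => ?_
    have h1 := hf j
    have h2 : (0 : ℝ) ≤ ∑' r : R j, z j ^ degree d (fun w => W.coeff r w) :=
      tsum_nonneg fun r => Real.rpow_nonneg (hz j).1 _
    have h3 : ∑ x, z j ^ d x = 0 :=
      Finset.sum_eq_zero fun x _ => by rw [h0, Real.zero_rpow (hd x).ne']
    rw [seriesValue, h3] at h1
    linarith
  set e : F → ℝ := fun r => degree d (fun w => W.coeff r w) with he
  have hword : ∀ j, ∀ r ∈ R j, ∃ w, W.coeff r w ≠ 0 ∧ wordDegree d w = e r ∧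
      ∀ v, wordDegree d v < e r → W.coeff r v = 0 := fun j r hr =>
    exists_wordDegree_eq_degree hd (hR j r hr).1
  obtain ⟨q, hq1, hq⟩ := exists_lt_one_frequently_truncated hd (ρ := fun j => R j)
    (fun j r => e r) (finite_range_wordDegree_inter_Iio hd)
    (fun j r => by obtain ⟨w, -, hw, -⟩ := hword j r r.2; exact ⟨w, hw⟩)
    z hz0 (fun j => (hz j).2) hs hf
  obtain ⟨δ, hδ, hδd⟩ := exists_pos_le hd
  set D : ℝ := 1 + ∑ x, d x with hD
  have hdD : ∀ x, d x ≤ D := fun x => by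
    linarith [Finset.single_le_sum (fun y _ => (hd y).le) (Finset.mem_univ x)]
  have hD1 : 1 ≤ D := by linarith [Finset.sum_nonneg fun x (_ : x ∈ Finset.univ) => (hd x).le]
  set L : Submodule k F := ⨆ j, I j with hL
  have hfin : ∀ t, Module.Finite k (F ⧸ L ⊔ W.degGE d t) := fun t => W.finite_quotient hd t L
  set a : ℝ → ℝ := fun t => Module.finrank k (F ⧸ L ⊔ W.degGE d t) with ha
  have hamono : Monotone a := fun s t h => by
    simp only [ha, Nat.cast_le]
    exact finrank_quotient_anti (sup_le_sup_left (W.degGE_anti h) L)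
  have ha0 : ∀ t ≤ 0, a t = 0 := fun t ht => by
    have h1 : L ⊔ W.degGE d t = ⊤ := by rw [W.degGE_eq_top hd ht, sup_top_eq]
    have h2 : Module.finrank k (F ⧸ L ⊔ W.degGE d t) = 0 := by
      rw [h1]; exact Module.finrank_zero_of_subsingleton
    simp only [ha, h2, Nat.cast_zero]
  -- The lower bound on the points at which truncated `f` is nonpositive: there `∑ y ^ d x ≥ 1`.
  obtain ⟨y₀, hy₀, hylow⟩ : ∃ y₀ : ℝ, 0 < y₀ ∧
      ∀ y : ℝ, 0 < y → y < 1 → 1 ≤ ∑ x, y ^ d x → y₀ ≤ y := by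
    refine ⟨(1 / (Fintype.card ι + 1 : ℝ)) ^ (1 / δ), by positivity, fun y hy hy1 h => ?_⟩
    have h1 : ∑ x, y ^ d x ≤ Fintype.card ι • y ^ δ := by
      rw [← Finset.card_univ]
      exact Finset.sum_le_card_nsmul _ _ _ fun x _ =>
        Real.rpow_le_rpow_of_exponent_ge hy hy1.le (hδd x)
    rw [nsmul_eq_mul] at h1
    have hyδ : 0 < y ^ δ := Real.rpow_pos_of_pos hy δ
    have h2 : 1 / (Fintype.card ι + 1 : ℝ) ≤ y ^ δ := by
      rw [div_le_iff₀ (by positivity)]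
      linarith
    refine (Real.rpow_le_rpow (by positivity) h2 (by positivity)).trans_eq ?_
    rw [← Real.rpow_mul hy.le, mul_one_div_cancel hδ.ne', Real.rpow_one]
  have hkey : ∀ T, D ≤ T → 0 < q ∧ y₀ ≤ Fintype.card ι * (D * (a T * q ^ (T - D))) := by
    intro T hT
    obtain ⟨j₀, hj₀⟩ := W.exists_forall_sup_degGE_eq hd hI T
    obtain ⟨j, hj, s, hsT, y, hy0, hyq, hy⟩ := frequently_atTop.1 (hq T) j₀
    have hepos : ∀ r ∈ s, 0 ≤ e r := fun r _ => by
      obtain ⟨w, -, hw, -⟩ := hword j r r.2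
      exact hw ▸ wordDegree_nonneg hd w
    have hideal : ∀ t ≤ T, ideal (R j) ⊔ W.degGE d t = L ⊔ W.degGE d t := by
      intro t ht
      rw [← hj₀ j hj t ht]
      obtain ⟨n, hn⟩ := exists_nat_ge (t / δ)
      rw [div_le_iff₀ hδ] at hn
      refine le_antisymm (sup_le_sup_right (hRI j) _) (sup_le ?_ le_sup_right)
      exact (hIR j n).trans (sup_le_sup_left (W.lenGE_le_degGE hδ.le hδd hn) _)
    refine ⟨hy0.trans_le hyq, le_trans (hylow y hy0 (hyq.trans_lt hq1) ?_)
      (le_mul_of_gs_inequality s hd hdD hepos hamono ha0 (hD1.trans hT) hT ?_ hy0 hyq hq1 hy)⟩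
    · linarith [Finset.sum_nonneg fun r (_ : r ∈ s) => Real.rpow_nonneg hy0.le (e r)]
    · intro t ht htT
      have h1 := W.gs_inequality hd (fun r hr => (hR j r hr).2) (e := e)
        (fun r hr => (hword j r hr).choose_spec.2.2) ht s
        (fun r hr => (hsT r).2 (hr.trans_le htT))
      rw [hideal t htT, Finset.sum_congr rfl fun x _ => by
        rw [hideal (t - d x) (by linarith [hd x])], Finset.sum_congr (s₁ := s) rfl fun r hr => by
        rw [hideal (t - e r) (by linarith [hepos r hr])]] at h1
      simp only [ha]
      exact_mod_cast h1
  have hq0 : 0 < q := (hkey D le_rfl).1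
  -- `a (n δ)` is at least a constant times `b ^ n` with `b > 1`; the constant is absorbed by
  -- passing to the square root of `b`.
  set c : ℝ := q ^ (-δ / 2) with hc
  have hc1 : 1 < c := Real.one_lt_rpow_of_pos_of_lt_one_of_neg hq0 hq1 (by linarith)
  refine ⟨c, hc1, ?_⟩
  set K : ℝ := Fintype.card ι * D * q ^ (-D) with hK
  filter_upwards [(tendsto_pow_atTop_atTop_of_one_lt hc1).eventually_ge_atTop (K / y₀),
    (tendsto_natCast_atTop_atTop (R := ℝ)).eventually_ge_atTop (D / δ)] with n hn1 hn2
  have hfinL := W.finite_quotient_lenGE n L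
  have h1 : a (n * δ) ≤ Module.finrank k (F ⧸ L ⊔ W.lenGE n) := by
    simp only [ha, Nat.cast_le]
    exact finrank_quotient_anti (sup_le_sup_left (W.lenGE_le_degGE hδ.le hδd le_rfl) L)
  have h2 := (hkey (n * δ) ((div_le_iff₀ hδ).1 hn2)).2
  have h3 : q ^ (n * δ - D) * (c ^ n * c ^ n) = q ^ (-D) := by
    rw [hc, ← pow_add, ← Real.rpow_natCast, ← Real.rpow_mul hq0.le, ← Real.rpow_add hq0]
    congr 1
    push_cast
    ring
  have hcn : 0 < c ^ n := by positivity
  have h4 : y₀ * (c ^ n * c ^ n) ≤ K * a (n * δ) := by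
    calc y₀ * (c ^ n * c ^ n)
        ≤ Fintype.card ι * (D * (a (n * δ) * q ^ (n * δ - D))) * (c ^ n * c ^ n) := by gcongr
      _ = Fintype.card ι * D * (q ^ (n * δ - D) * (c ^ n * c ^ n)) * a (n * δ) := by ring
      _ = K * a (n * δ) := by rw [h3]
  have h5 : K ≤ c ^ n * y₀ := (div_le_iff₀ hy₀).1 hn1
  have h6 : K * a (n * δ) ≤ c ^ n * y₀ * a (n * δ) :=
    mul_le_mul_of_nonneg_right h5 (Nat.cast_nonneg _)
  have h7 : (y₀ * c ^ n) * c ^ n ≤ (y₀ * c ^ n) * a (n * δ) := by linarith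
  exact (le_of_mul_le_mul_left h7 (by positivity)).trans h1

end WordAlgebra

end GolodShafarevich

/-! ### Renaming variables, and homomorphisms to separated quotients -/

namespace NCPowerSeries

variable {k ι : Type*} [Field k]

open Classical in
theorem prod_map_X (w v : List ι) :
    ((w.map X).prod : NCPowerSeries k ι) v = if v = w then 1 else 0 := by
  induction w generalizing v with
  | nil => cases v <;> simp [one_nil, one_cons]
  | cons x w ih =>
    rw [List.map_cons, List.prod_cons]
    cases v with
    | nil => simp [mul_nil, X_nil]
    | cons y v =>
      rw [X_mul_cons, ih]
      by_cases hy : y = x <;> simp [hy]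

/-- Renaming of the variables along a bijection. -/
noncomputable def reindex {κ : Type*} (e : ι ≃ κ) : NCPowerSeries k κ →ₐ[k] NCPowerSeries k ι :=
  AlgHom.ofLinearMap
    { toFun := fun f w => f (w.map e)
      map_add' := fun _ _ => rfl
      map_smul' := fun _ _ => rfl }
    (by
      ext w
      cases w <;> rfl)
    (fun f g => by
      ext w
      change (f * g) (w.map e) = _
      rw [mul_apply, mul_apply, List.length_map]
      refine Finset.sum_congr rfl fun i _ => ?_
      simp only [← List.map_take, ← List.map_drop]
      rfl)

theorem reindex_apply {κ : Type*} (e : ι ≃ κ) (f : NCPowerSeries k κ) (w : List ι) :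
    reindex e f w = f (w.map e) := rfl

theorem reindex_symm_reindex {κ : Type*} (e : ι ≃ κ) (f : NCPowerSeries k ι) :
    reindex e (reindex e.symm f) = f := by
  ext w
  simp [reindex_apply]

theorem reindex_mem_lengthFiltration {κ : Type*} (e : ι ≃ κ) {f : NCPowerSeries k κ} {n : ℕ}
    (hf : f ∈ lengthFiltration k κ n) : reindex e f ∈ lengthFiltration k ι n :=
  fun w hw => hf (w.map e) (by simpa using hw)

theorem eq_algebraMap_add_sum_X_mul [Fintype ι] (f : NCPowerSeries k ι) :
    f = algebraMap k _ (f []) + ∑ x, X x * shift x f := by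
  classical
  ext w
  rw [add_apply, sum_apply]
  cases w with
  | nil => simp [algebraMap_nil, mul_nil, X_nil]
  | cons y w =>
    rw [algebraMap_cons, zero_add, Finset.sum_congr rfl fun x _ => X_mul_cons (shift x f) x y w]
    simp [shift]

/-- The series `f'` with `f' w = f (w x)`. -/
def shiftRight (x : ι) (f : NCPowerSeries k ι) : NCPowerSeries k ι := fun w => f (w ++ [x])

theorem eq_algebraMap_add_sum_mul_X [Fintype ι] (f : NCPowerSeries k ι) :
    f = algebraMap k _ (f []) + ∑ x, shiftRight x f * X x := by
  classical
  ext w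
  rw [add_apply, sum_apply]
  rcases List.eq_nil_or_concat w with rfl | ⟨v, y, rfl⟩
  · simp [algebraMap_nil, mul_X_nil]
  · have h : algebraMap k (NCPowerSeries k ι) (f []) (v ++ [y]) = 0 := by
      cases v <;> exact algebraMap_cons _ _ _
    rw [List.concat_eq_append, h, zero_add, Finset.sum_congr rfl fun x _ => mul_X_append _ x y v]
    simp [shiftRight]

theorem X_mul_mem_lengthFiltration (x : ι) {f : NCPowerSeries k ι} {n : ℕ}
    (hf : f ∈ lengthFiltration k ι n) : X x * f ∈ lengthFiltration k ι (n + 1) := by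
  classical
  intro w hw
  cases w with
  | nil => rw [mul_nil, X_nil, zero_mul]
  | cons y w =>
    rw [X_mul_cons, hf w (by simpa using hw), ite_self]

/-- Homomorphisms to a separated quotient of `k⟪ι⟫` are determined by their values at the
variables: continuity is automatic. Indeed `f = f₀ + ∑ x f_x` shows, by induction on `n`, that the
difference of the two values at `f` lies in the image of the series without monomials of length
less than `n`. -/
theorem algHom_ext_of_separated [Fintype ι] {B : Type*} [Ring B] [Algebra k B]
    {π ψ : NCPowerSeries k ι →ₐ[k] B} (hπ : Function.Surjective π)
    (hsep : ∀ b, (∀ n, b ∈ (lengthFiltration k ι n).map π.toLinearMap) → b = 0)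
    (h : ∀ x, ψ (X x) = π (X x)) : ψ = π := by
  suffices ∀ n f, ψ f - π f ∈ (lengthFiltration k ι n).map π.toLinearMap from
    AlgHom.ext fun f => sub_eq_zero.1 (hsep _ fun n => this n f)
  intro n
  induction n with
  | zero =>
    intro f
    obtain ⟨l, hl⟩ := hπ (ψ f - π f)
    exact ⟨l, fun w hw => absurd hw (Nat.not_lt_zero _), hl⟩
  | succ n ih =>
    intro f
    have hf : ψ f - π f = ∑ x, π (X x) * (ψ (shift x f) - π (shift x f)) := by
      conv_lhs => rw [eq_algebraMap_add_sum_X_mul f]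
      simp only [map_add, map_sum, map_mul, AlgHom.commutes, h, add_sub_add_left_eq_sub, mul_sub,
        Finset.sum_sub_distrib]
    rw [hf]
    refine Submodule.sum_mem _ fun x _ => ?_
    obtain ⟨l, hl, hl'⟩ := ih (shift x f)
    exact ⟨X x * l, X_mul_mem_lengthFiltration x hl, by
      rw [← hl']; exact map_mul π _ _⟩

end NCPowerSeries

namespace GolodShafarevich

/-! ### The free algebra and the completed free algebra -/

theorem wordCoeff_eq_lift {k ι : Type*} [Field k] (f : FreeAlgebra k ι) (w : List ι) :
    wordCoeff f w = FreeAlgebra.lift k (NCPowerSeries.X (k := k)) f w := by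
  classical
  obtain ⟨p, rfl⟩ := FreeAlgebra.equivMonoidAlgebraFreeMonoid.symm.surjective f
  rw [wordCoeff, AlgEquiv.apply_symm_apply]
  induction p using MonoidAlgebra.induction_linear with
  | zero => rw [map_zero, map_zero]; rfl
  | add p q hp hq => rw [map_add, map_add, NCPowerSeries.add_apply, ← hp, ← hq]; rfl
  | single v c =>
    have h1 : FreeAlgebra.equivMonoidAlgebraFreeMonoid.symm (MonoidAlgebra.single v c) =
        c • ((FreeMonoid.toList v).map (FreeAlgebra.ι k)).prod := by
      simp [FreeAlgebra.equivMonoidAlgebraFreeMonoid, FreeMonoid.lift_apply]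
    rw [h1, map_smul, map_list_prod, List.map_map, NCPowerSeries.smul_apply]
    have h2 : (FreeAlgebra.lift k (NCPowerSeries.X (k := k)) : FreeAlgebra k ι → _) ∘
        FreeAlgebra.ι k = NCPowerSeries.X := FreeAlgebra.ι_comp_lift _
    rw [h2, NCPowerSeries.prod_map_X]
    rw [MonoidAlgebra.coeff_single, Finsupp.single_apply, mul_ite, mul_one, mul_zero]
    exact if_congr ⟨fun h => h ▸ rfl, fun h => h ▸ rfl⟩ rfl rfl

theorem exists_wordCoeff_ne_zero {k ι : Type*} [Field k] {f : FreeAlgebra k ι} (hf : f ≠ 0) :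
    ∃ w, wordCoeff f w ≠ 0 := by
  by_contra! h
  refine hf (FreeAlgebra.equivMonoidAlgebraFreeMonoid.injective ?_)
  rw [map_zero]
  ext v
  exact h (FreeMonoid.toList v)

namespace WordAlgebra

variable {k ι : Type*} [Field k] [Fintype ι]

/-- The completed free algebra. -/
noncomputable def ofPowerSeries : WordAlgebra k ι (NCPowerSeries k ι) where
  coeff := AlgHom.id k _
  gen := NCPowerSeries.X
  coeff_gen _ := rfl
  exists_eq f := ⟨_, NCPowerSeries.eq_algebraMap_add_sum_mul_X f⟩

theorem exists_eq_algebraMap_add_sum_mul_ι (f : FreeAlgebra k ι) : ∃ u : ι → FreeAlgebra k ι,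
    f = algebraMap k _ (FreeAlgebra.lift k (NCPowerSeries.X (k := k)) f []) +
      ∑ x, u x * FreeAlgebra.ι k x := by
  classical
  induction f using FreeAlgebra.induction with
  | grade0 r => exact ⟨0, by simp [NCPowerSeries.algebraMap_nil]⟩
  | grade1 x =>
    refine ⟨Pi.single x 1, ?_⟩
    rw [FreeAlgebra.lift_ι_apply, NCPowerSeries.X_nil, map_zero, zero_add,
      Finset.sum_eq_single x (fun y _ hy => by simp [hy]) (by simp), Pi.single_eq_same, one_mul]
  | mul a b ha hb =>
    rw [map_mul, NCPowerSeries.mul_nil]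
    generalize FreeAlgebra.lift k (NCPowerSeries.X (k := k)) a [] = a₀ at *
    generalize FreeAlgebra.lift k (NCPowerSeries.X (k := k)) b [] = b₀ at *
    obtain ⟨u, hu⟩ := ha
    obtain ⟨v, hv⟩ := hb
    refine ⟨fun x => b₀ • u x + a * v x, ?_⟩
    have h : a * b = b₀ • a + a * ∑ x, v x * FreeAlgebra.ι k x := by
      rw [Algebra.smul_def, Algebra.commutes, ← mul_add, ← hv]
    have h' : b₀ • a = algebraMap k _ (a₀ * b₀) + b₀ • ∑ x, u x * FreeAlgebra.ι k x := by
      rw [mul_comm, map_mul, ← Algebra.smul_def, ← smul_add, ← hu]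
    rw [h, h', Finset.mul_sum, Finset.smul_sum, add_assoc, ← Finset.sum_add_distrib]
    simp only [add_mul, smul_mul_assoc, mul_assoc]
  | add a b ha hb =>
    rw [map_add, NCPowerSeries.add_apply, map_add]
    generalize algebraMap k (FreeAlgebra k ι)
      (FreeAlgebra.lift k (NCPowerSeries.X (k := k)) a []) = a₀ at *
    generalize algebraMap k (FreeAlgebra k ι)
      (FreeAlgebra.lift k (NCPowerSeries.X (k := k)) b []) = b₀ at *
    obtain ⟨u, hu⟩ := ha
    obtain ⟨v, hv⟩ := hb
    refine ⟨u + v, ?_⟩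
    simp only [Pi.add_apply, add_mul, Finset.sum_add_distrib]
    rw [add_add_add_comm, ← hu, ← hv]

/-- The free algebra. -/
noncomputable def ofFreeAlgebra : WordAlgebra k ι (FreeAlgebra k ι) where
  coeff := FreeAlgebra.lift k NCPowerSeries.X
  gen := FreeAlgebra.ι k
  coeff_gen x := FreeAlgebra.lift_ι_apply _ x
  exists_eq := exists_eq_algebraMap_add_sum_mul_ι

end WordAlgebra

theorem finrank_quotient_ker_sup {k F B : Type*} [Field k] [AddCommGroup F] [Module k F]
    [AddCommGroup B] [Module k B] {q : F →ₗ[k] B} (hq : Function.Surjective q)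
    (M : Submodule k F) :
    Module.finrank k (F ⧸ LinearMap.ker q ⊔ M) = Module.finrank k (B ⧸ M.map q) := by
  have h : LinearMap.ker ((M.map q).mkQ ∘ₗ q) = LinearMap.ker q ⊔ M := by
    rw [LinearMap.ker_comp, Submodule.ker_mkQ, Submodule.comap_map_eq, sup_comm]
  exact ((Submodule.quotEquivOfEq _ _ h.symm).trans (LinearMap.quotKerEquivOfSurjective
    ((M.map q).mkQ ∘ₗ q) ((Submodule.mkQ_surjective _).comp hq))).finrank_eq

/-! ### The two notions of exponential growth -/

section Growth

variable {k ι B : Type*} [Field k] [Fintype ι] [Ring B] [Algebra k B]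

theorem hasCompletedExponentialGrowth_of_le {q : NCPowerSeries k ι →ₐ[k] B}
    (hq : Function.Surjective q) {c : ℝ} (hc : 1 < c)
    (h : ∀ᶠ n : ℕ in atTop, c ^ n ≤ Module.finrank k (NCPowerSeries k ι ⧸
      LinearMap.ker q.toLinearMap ⊔ WordAlgebra.ofPowerSeries.lenGE n)) :
    HasCompletedExponentialGrowth k B := by
  let e := Fintype.equivFin ι
  refine ⟨Fintype.card ι, q.comp (NCPowerSeries.reindex e), fun b => ?_, c, hc, ?_⟩
  · obtain ⟨f, rfl⟩ := hq b
    exact ⟨NCPowerSeries.reindex e.symm f, congr_arg q (NCPowerSeries.reindex_symm_reindex e f)⟩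
  · filter_upwards [h] with n hn
    rw [finrank_quotient_ker_sup (q := q.toLinearMap) hq] at hn
    suffices h1 : (NCPowerSeries.lengthFiltration k (Fin (Fintype.card ι)) n).map
        (q.comp (NCPowerSeries.reindex e)).toLinearMap =
        (WordAlgebra.ofPowerSeries.lenGE n).map q.toLinearMap by
      rwa [h1]
    refine le_antisymm ?_ ?_
    · rintro _ ⟨f, hf, rfl⟩
      exact ⟨NCPowerSeries.reindex e f, NCPowerSeries.reindex_mem_lengthFiltration e hf, rfl⟩
    · rintro _ ⟨f, hf, rfl⟩
      exact ⟨NCPowerSeries.reindex e.symm f,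
        NCPowerSeries.reindex_mem_lengthFiltration e.symm hf,
        congr_arg q (NCPowerSeries.reindex_symm_reindex e f)⟩

theorem hasExponentialGrowth_of_le {q : FreeAlgebra k ι →ₐ[k] B}
    (hq : Function.Surjective q) {c : ℝ} (hc : 1 < c)
    (h : ∀ᶠ n : ℕ in atTop, c ^ n ≤ Module.finrank k (FreeAlgebra k ι ⧸
      LinearMap.ker q.toLinearMap ⊔ WordAlgebra.ofFreeAlgebra.lenGE n)) :
    HasExponentialGrowth k B := by
  classical
  let W : WordAlgebra k ι (FreeAlgebra k ι) := WordAlgebra.ofFreeAlgebra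
  let s : Finset B := Finset.univ.image fun x => q (FreeAlgebra.ι k x)
  have hs : (s : Set B) = q '' Set.range (FreeAlgebra.ι k) := by
    rw [Finset.coe_image, Finset.coe_univ, Set.image_univ, ← Set.range_comp]; rfl
  refine ⟨s, ?_, c, hc, ?_⟩
  · rw [hs, ← AlgHom.map_adjoin, FreeAlgebra.adjoin_range_ι, Algebra.map_top]
    exact (AlgHom.range_eq_top q).2 hq
  set V : Submodule k B := Submodule.span k (insert 1 (s : Set B)) with hV
  have h1V : (1 : B) ∈ V := Submodule.subset_span (Set.mem_insert _ _)
  have hgen : ∀ x, q (W.gen x) ∈ V := fun x => Submodule.subset_span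
    (Set.mem_insert_of_mem _ (by rw [hs]; exact ⟨_, ⟨x, rfl⟩, rfl⟩))
  have hspan : ∀ n f, q f ∈ V ^ n ⊔ (W.lenGE n).map q.toLinearMap := by
    intro n
    induction n with
    | zero =>
      exact fun f => Submodule.mem_sup_right
        ⟨f, fun w hw => absurd hw (Nat.not_lt_zero _), rfl⟩
    | succ n ih =>
      intro f
      obtain ⟨u, hu⟩ := W.exists_eq f
      rw [hu, map_add, map_sum]
      refine add_mem (Submodule.mem_sup_left ?_) (Submodule.sum_mem _ fun x _ => ?_)
      · rw [AlgHom.commutes, Algebra.algebraMap_eq_smul_one]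
        exact Submodule.smul_mem _ _ (by simpa using Submodule.pow_mem_pow V h1V (n + 1))
      · obtain ⟨v, hv, _, ⟨l, hl, rfl⟩, hvl⟩ := Submodule.mem_sup.1 (ih (u x))
        rw [map_mul, ← hvl, add_mul, pow_succ]
        refine Submodule.add_mem_sup (Submodule.mul_mem_mul hv (hgen x))
          ⟨l * W.gen x, ?_, map_mul q _ _⟩
        have hl' := hl
        rw [SetLike.mem_coe, WordAlgebra.lenGE_eq_degGE] at hl' ⊢
        rw [Nat.cast_succ]
        exact W.mul_mem_degGE hl' (W.gen_mem_degGE (d := fun _ => 1) x)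
  filter_upwards [h] with n hn
  rw [finrank_quotient_ker_sup (q := q.toLinearMap) hq] at hn
  refine hn.trans ?_
  have hfg : Module.Finite k ↥(V ^ n) :=
    Module.Finite.iff_fg.2 (Submodule.FG.pow
      (Submodule.fg_span ((Finset.finite_toSet s).insert 1)) n)
  have hsurj : Function.Surjective
      (((W.lenGE n).map q.toLinearMap).mkQ ∘ₗ (V ^ n).subtype) := by
    intro b
    obtain ⟨b, rfl⟩ := Submodule.mkQ_surjective _ b
    obtain ⟨f, rfl⟩ := hq b
    obtain ⟨v, hv, l, hl, hvl⟩ := Submodule.mem_sup.1 (hspan n f)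
    refine ⟨⟨v, hv⟩, (Submodule.Quotient.eq _).2 ?_⟩
    rw [← hvl]
    simpa using hl
  exact_mod_cast LinearMap.finrank_le_finrank_of_surjective hsurj

end Growth

/-! ### Kernels of the maps to the direct limit -/

section Limit

variable {k : Type*} [Field k] {A : ℕ → Type*} [∀ i, Ring (A i)] [∀ i, Algebra k (A i)]
  {φ : ∀ i j, i ≤ j → A i →ₐ[k] A j}

theorem monotone_ker {F : Type*} [Ring F] [Algebra k F] {n : ℕ → ℕ} (hn : StrictMono n)
    {π : ∀ j, F →ₐ[k] A (n j)}
    (hπ : ∀ i j (h : i ≤ j), (φ _ _ (hn.monotone h)).comp (π i) = π j) :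
    Monotone fun j => LinearMap.ker (π j).toLinearMap := by
  intro i j h f hf
  have h1 : π i f = 0 := hf
  change π j f = 0
  rw [← hπ i j h, AlgHom.comp_apply, h1, map_zero]

variable [DirectedSystem A (φ · · ·)]

theorem directLimit_of_surjective (hφ : ∀ i j h, Function.Surjective (φ i j h)) (i : ℕ) :
    Function.Surjective (DirectLimit.Algebra.of (R := k) A φ i) := by
  intro b
  induction b using DirectLimit.induction with
  | _ j a =>
    obtain ⟨a', ha'⟩ := hφ i (max i j) (le_max_left _ _) (φ j _ (le_max_right _ _) a)
    refine ⟨a', ?_⟩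
    rw [← DirectLimit.Algebra.of_f (le_max_left i j) a', ha', DirectLimit.Algebra.of_f]
    rfl

theorem exists_map_eq_zero {i : ℕ} {a : A i} (h : DirectLimit.Algebra.of (R := k) A φ i a = 0) :
    ∃ j₀, ∀ j ≥ j₀, ∀ hij : i ≤ j, φ i j hij a = 0 := by
  rw [← map_zero (DirectLimit.Algebra.of (R := k) A φ i)] at h
  obtain ⟨j₀, h1, h2, h3⟩ := Quotient.exact h
  refine ⟨j₀, fun j hj hij => ?_⟩
  have h4 : φ i j₀ h1 a = 0 := h3.trans (map_zero _)
  rw [← DirectedSystem.map_map' (f := (φ · · ·)) h1 hj]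
  exact (congr_arg _ h4).trans (map_zero _)

theorem iSup_ker_eq {F : Type*} [Ring F] [Algebra k F] {n : ℕ → ℕ} (hn : StrictMono n)
    {π : ∀ j, F →ₐ[k] A (n j)}
    (hπ : ∀ i j (h : i ≤ j), (φ _ _ (hn.monotone h)).comp (π i) = π j) :
    ⨆ j, LinearMap.ker (π j).toLinearMap =
      LinearMap.ker ((DirectLimit.Algebra.of (R := k) A φ (n 0)).comp (π 0)).toLinearMap := by
  refine le_antisymm (iSup_le fun j f hf => ?_) fun f hf => ?_
  · have h1 : π j f = 0 := hf
    rw [← hπ 0 j (Nat.zero_le j)] at h1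
    change DirectLimit.Algebra.of (R := k) A φ (n 0) (π 0 f) = 0
    rw [← DirectLimit.Algebra.of_f (hn.monotone (Nat.zero_le j))]
    exact (congr_arg _ h1).trans (map_zero _)
  · obtain ⟨j, hj⟩ := exists_map_eq_zero (k := k) (φ := φ) hf
    refine Submodule.mem_iSup_of_mem j ?_
    change π j f = 0
    rw [← hπ 0 j (Nat.zero_le j)]
    exact hj (n j) (hn.id_le j) _

end Limit

/-! ### Separated quotients of the completed free algebra -/

section Separated

variable {k ι B : Type*} [Field k] [Ring B] [Algebra k B]

/-- A quotient of `k⟪ι⟫` by a closed ideal is separated. -/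
theorem eq_zero_of_forall_mem_map {π : NCPowerSeries k ι →ₐ[k] B} {R : Set (NCPowerSeries k ι)}
    (h : IsCompletedPresentedBy π R) (b : B)
    (hb : ∀ n, b ∈ (NCPowerSeries.lengthFiltration k ι n).map π.toLinearMap) : b = 0 := by
  obtain ⟨f, rfl⟩ := h.2.1 b
  refine (h.2.2 f).2 fun n => ?_
  obtain ⟨l, hl, hlf⟩ := hb n
  have h1 : π (f - l) = 0 := by
    rw [map_sub, sub_eq_zero]
    exact hlf.symm
  obtain ⟨g, hg, hgl⟩ := (h.2.2 _).1 h1 n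
  refine ⟨g, hg, ?_⟩
  rw [show f - g = f - l - g + l by abel]
  exact add_mem hgl hl

theorem ker_sup_lengthFiltration_of_isSeparatedQuotient {L : Type*} [Ring L] [Algebra k L]
    {q : NCPowerSeries k ι →ₐ[k] L} {p : L →ₐ[k] B} (h : IsSeparatedQuotient q p) (n : ℕ) :
    LinearMap.ker (p.comp q).toLinearMap ⊔ NCPowerSeries.lengthFiltration k ι n =
      LinearMap.ker q.toLinearMap ⊔ NCPowerSeries.lengthFiltration k ι n := by
  refine le_antisymm (sup_le (fun f hf => ?_) le_sup_right) (sup_le_sup_right (fun f hf => ?_) _)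
  · have h1 : f ∈ ((NCPowerSeries.lengthFiltration k ι n).map q.toLinearMap).comap
        q.toLinearMap := (h.2 _).1 hf n
    rwa [Submodule.comap_map_eq, sup_comm] at h1
  · exact (congr_arg p hf).trans (map_zero p)

end Separated

/-! ### Direct limits with constant generators -/

theorem exists_strictMono_const_and {α : Type*} [Finite α] (S : ℕ → α) {P : ℕ → Prop}
    (hP : ∀ᶠ i in atTop, P i) : ∃ n : ℕ → ℕ, StrictMono n ∧ ∀ j, S (n j) = S (n 0) ∧ P (n j) := by
  obtain ⟨s, hs⟩ := Finite.exists_infinite_fiber S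
  have h1 : ∃ᶠ i in atTop, S i = s :=
    Nat.frequently_atTop_iff_infinite.2 (Set.infinite_coe_iff.1 hs)
  obtain ⟨n, hn, h⟩ := extraction_of_frequently_atTop (h1.and_eventually hP)
  exact ⟨n, hn, fun j => ⟨(h j).1.trans (h 0).1.symm, (h j).2⟩⟩

section Limit

variable {k : Type*} [Field k] {A : ℕ → Type*} [∀ i, Ring (A i)] [∀ i, Algebra k (A i)]
  {φ : ∀ i j, i ≤ j → A i →ₐ[k] A j} [DirectedSystem A (φ · · ·)]
  {ι : Type*} [Fintype ι] {d : ι → ℝ} {n : ℕ → ℕ}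

/-- Golod–Shafarevich algebras on the same generators: the finitely generated case. -/
theorem hasExponentialGrowth_directLimit (hn : StrictMono n)
    (hφ : ∀ i j h, Function.Surjective (φ i j h))
    (hd : ∀ x, 0 < d x) {π : ∀ j, FreeAlgebra k ι →ₐ[k] A (n j)}
    (hπ : ∀ i j (h : i ≤ j), (φ _ _ (hn.monotone h)).comp (π i) = π j)
    (hGS : ∀ j, IsGS (π j) d) : HasExponentialGrowth k (DirectLimit A φ) := by
  choose R hR z hz hs hf using hGS
  have hcoeff : (wordCoeff : FreeAlgebra k ι → List ι → k) =
      fun f w => WordAlgebra.ofFreeAlgebra.coeff f w :=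
    funext fun f => funext fun w => wordCoeff_eq_lift f w
  obtain ⟨c, hc, h⟩ := WordAlgebra.ofFreeAlgebra.exists_pow_le_finrank hd (monotone_ker hn hπ) R
    (fun j r hr => by
      have h1 := (hR j).1 r hr
      obtain ⟨w, hw⟩ := exists_wordCoeff_ne_zero h1.1
      rw [hcoeff] at hw h1
      exact ⟨⟨w, hw⟩, h1.2⟩)
    (fun j f hf => ((hR j).2.2 f).2 (WordAlgebra.mem_ideal.1 hf))
    (fun j m f hf => Submodule.mem_sup_left (WordAlgebra.mem_ideal.2 (((hR j).2.2 f).1 hf)))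
    z hz (hcoeff ▸ hs) (hcoeff ▸ hf)
  rw [iSup_ker_eq hn hπ] at h
  exact hasExponentialGrowth_of_le
    ((directLimit_of_surjective hφ (n 0)).comp (hR 0).2.1) hc h

/-- Golod–Shafarevich algebras on the same generators: the completed case, for the algebraic
direct limit, in terms of the kernel of the map from `k⟪ι⟫`. -/
theorem exists_pow_le_finrank_directLimit (hn : StrictMono n)
    (hd : ∀ x, 0 < d x) {π : ∀ j, NCPowerSeries k ι →ₐ[k] A (n j)}
    (hπ : ∀ i j (h : i ≤ j), (φ _ _ (hn.monotone h)).comp (π i) = π j)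
    (hGS : ∀ j, IsCompletedGS (π j) d) :
    ∃ c : ℝ, 1 < c ∧ ∀ᶠ m : ℕ in atTop, c ^ m ≤ Module.finrank k (NCPowerSeries k ι ⧸
      LinearMap.ker ((DirectLimit.Algebra.of (R := k) A φ (n 0)).comp (π 0)).toLinearMap ⊔
        WordAlgebra.ofPowerSeries.lenGE m) := by
  choose R hR z hz hs hf using hGS
  rw [← iSup_ker_eq hn hπ]
  refine WordAlgebra.ofPowerSeries.exists_pow_le_finrank hd (monotone_ker hn hπ) R
    (fun j r hr => ⟨?_, ((hR j).1 r hr).2⟩) (fun j f hf => ?_) (fun j m f hf => ?_) z hz hs hf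
  · by_contra! h
    exact ((hR j).1 r hr).1 (NCPowerSeries.ext h)
  · refine ((hR j).2.2 f).2 fun m => ⟨f, WordAlgebra.mem_ideal.1 hf, ?_⟩
    rw [sub_self]
    exact zero_mem _
  · obtain ⟨g, hg, hfg⟩ := ((hR j).2.2 f).1 hf m
    exact Submodule.mem_sup.2 ⟨g, WordAlgebra.mem_ideal.2 hg, f - g, hfg, add_sub_cancel _ _⟩

end Limit

end GolodShafarevich

open GolodShafarevich in
theorem corollary1 {k : Type*} [Field k] {X : Type*} [Finite X]
    (deg : X → ℝ) (hdeg : ∀ x, 0 < deg x)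
    (A : ℕ → Type*) [∀ i, Ring (A i)] [∀ i, Algebra k (A i)]
    (φ : ∀ i j, i ≤ j → A i →ₐ[k] A j) [DirectedSystem A (φ · · ·)]
    (hφ : ∀ i j h, Function.Surjective (φ i j h))
    (g : ∀ i, X → A i) (hg : ∀ i j h x, φ i j h (g i x) = g j x)
    (S : ℕ → Finset X) :
    ((∀ i, IsWeakGS (FreeAlgebra.lift k fun x : S i => g i x) (fun x => deg x)) →
      (∀ᶠ i in Filter.atTop,
        IsGS (FreeAlgebra.lift k fun x : S i => g i x) (fun x => deg x)) →
      HasExponentialGrowth k (DirectLimit A φ)) ∧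
    (∀ π : ∀ i, NCPowerSeries k (S i) →ₐ[k] A i,
      (∀ i (x : S i), π i (NCPowerSeries.X x) = g i x) →
      (∀ i, IsCompletedWeakGS (π i) (fun x => deg x)) →
      (∀ᶠ i in Filter.atTop, IsCompletedGS (π i) (fun x => deg x)) →
      HasCompletedExponentialGrowth k (DirectLimit A φ) ∧
      ∀ (B : Type*) [Ring B] [Algebra k B] (p : DirectLimit A φ →ₐ[k] B),
        (∀ i, IsSeparatedQuotient ((DirectLimit.Algebra.of A φ i).comp (π i)) p) →
        HasCompletedExponentialGrowth k B) := by
  refine ⟨fun _ hGS => ?_, fun π hπ _ hGS => ?_⟩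
  · obtain ⟨n, hn, h⟩ := exists_strictMono_const_and S hGS
    have hcast : ∀ i S', S i = S' →
        IsGS (FreeAlgebra.lift k fun x : S i => g i x) (fun x => deg x) →
        IsGS (FreeAlgebra.lift k fun x : S' => g i x) (fun x => deg x) := by
      rintro i _ rfl h
      exact h
    refine hasExponentialGrowth_directLimit hn hφ (d := fun x : S (n 0) => deg x)
      (fun x => hdeg x) (π := fun j => FreeAlgebra.lift k fun x : S (n 0) => g (n j) x)
      (fun i j hij => FreeAlgebra.hom_ext (funext fun x => ?_))
      fun j => hcast _ _ (h j).1 (h j).2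
    simp [hg]
  · obtain ⟨n, hn, h⟩ := exists_strictMono_const_and S hGS
    have hcast : ∀ i S', S i = S' → IsCompletedGS (π i) (fun x => deg x) →
        ∃ π' : NCPowerSeries k S' →ₐ[k] A i, (∀ x : S', π' (NCPowerSeries.X x) = g i x) ∧
          IsCompletedGS π' (fun x => deg x) := by
      rintro i _ rfl h
      exact ⟨π i, hπ i, h⟩
    choose π' hπ' hGS' using fun j => hcast _ _ (h j).1 (h j).2
    have hext : ∀ j (ψ : NCPowerSeries k (S (n 0)) →ₐ[k] A (n j)),
        (∀ x : S (n 0), ψ (NCPowerSeries.X x) = g (n j) x) → ψ = π' j := fun j ψ hψ => by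
      obtain ⟨R, hR, -⟩ := hGS' j
      exact NCPowerSeries.algHom_ext_of_separated hR.2.1 (eq_zero_of_forall_mem_map hR)
        fun x => (hψ x).trans (hπ' j x).symm
    obtain ⟨c, hc, hgrowth⟩ := exists_pow_le_finrank_directLimit (φ := φ) hn
      (d := fun x : S (n 0) => deg x) (fun x => hdeg x) (π := π')
      (fun i j hij => hext j _ fun x => by rw [AlgHom.comp_apply, hπ', hg]) hGS'
    have hsurj : Function.Surjective
        ((DirectLimit.Algebra.of (R := k) A φ (n 0)).comp (π' 0)) := by
      obtain ⟨R, hR, -⟩ := hGS' 0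
      exact (directLimit_of_surjective hφ (n 0)).comp hR.2.1
    refine ⟨hasCompletedExponentialGrowth_of_le hsurj hc hgrowth, fun B _ _ p hp => ?_⟩
    have hp0 := hp (n 0)
    rw [hext 0 _ (hπ (n 0))] at hp0
    refine hasCompletedExponentialGrowth_of_le
      (q := p.comp ((DirectLimit.Algebra.of A φ (n 0)).comp (π' 0))) (hp0.1.comp hsurj) hc ?_
    filter_upwards [hgrowth] with m hm
    exact hm.trans_eq (congr_arg (fun M : Submodule k (NCPowerSeries k (S (n 0))) =>
      (Module.finrank k (_ ⧸ M) : ℝ)) (ker_sup_lengthFiltration_of_isSeparatedQuotient hp0 m).symm)
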